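/- There are functions $B_0(R,d)$ and $p_0(s,d)$ such that the following holds for all integers $R,d,s\ge 1$ and all primes $p>p_0(s,d)$. Let $g_1,\dots,g_R\in\mathbb F_p[x_1,\dots,x_s]$ be homogeneous forms of degrees between $1$ and $d$. For $1\le l\le d$ let $\mathcal G^{(l)}$ be the system of those $g_i$ that have degree $l$, and let $R_l$ be their number. Assume that each non-empty block $\mathcal G^{(l)}$ has Birch rank at least $B_0(R,d)$ over $\overline{\mathbb F}_p$, in the sense that for every $0\ne\mathbf b\in\overline{\mathbb F}_p^{R_l}$ the singular locus $\{z\in\overline{\mathbb F}_p^{s}:\nabla(\mathbf b\cdot\mathcal G^{(l)})(z)=0\}$ has codimension at least $B_0(R,d)$ in $\mathbb A^s_{\overline{\mathbb F}_p}$ (the empty set has infinite codimension). Then the set $V_{\mathcal G}=\{x\in\mathbb F_p^s: g_1(x)=\dots=g_R(x)=0\}$ satisfies $$\bigl||V_{\mathcal G}|-p^{s-R}\bigr|\le p^{s-R-1}.$$ -/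

import Mathlib

open MvPolynomial

/-- The dimension of a subset `Z` of the affine space `K ^ s`: the Krull dimension of the coordinate
ring of its Zariski closure. The empty set has dimension `⊥`. -/
noncomputable def affineDim {K : Type*} [Field K] {s : ℕ} (Z : Set (Fin s → K)) : WithBot ℕ∞ :=
  ringKrullDim (MvPolynomial (Fin s) K ⧸ vanishingIdeal K Z)

/-- `Z` has codimension at least `B` in the affine space `K ^ s`, i.e. `dim Z + B ≤ s`. The empty
set has infinite codimension, so it satisfies this for every `B`. -/
def CodimAtLeast {K : Type*} [Field K] {s : ℕ} (Z : Set (Fin s → K)) (B : ℕ) : Prop :=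
  affineDim Z + (B : WithBot ℕ∞) ≤ (s : WithBot ℕ∞)

/-- The singular locus `{z : ∇f(z) = 0}` of a form `f`. -/
def singularLocus {K : Type*} [Field K] {s : ℕ} (f : MvPolynomial (Fin s) K) :
    Set (Fin s → K) :=
  {z | ∀ j, eval z (pderiv j f) = 0}

/-- Given a system `g` of forms over `k`, where `g i` has degree `deg i`, the block of the forms of
degree `l` has Birch rank at least `B` over the algebraic closure of `k`: every nontrivial linear
combination of these forms over the algebraic closure has singular locus of codimension at
least `B`. -/
def BlockBirchRankAtLeast {k : Type*} [Field k] {R s : ℕ} (g : Fin R → MvPolynomial (Fin s) k)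
    (deg : Fin R → ℕ) (l B : ℕ) : Prop :=
  ∀ b : {i : Fin R // deg i = l} → AlgebraicClosure k, b ≠ 0 →
    CodimAtLeast
      (singularLocus (∑ i, C (b i) * map (algebraMap k (AlgebraicClosure k)) (g i.1))) B

/-- The set of common zeros of the system `g` in `k ^ s`. -/
def commonZeros {k : Type*} [Field k] {R s : ℕ} (g : Fin R → MvPolynomial (Fin s) k) :
    Set (Fin s → k) :=
  {x | ∀ i, eval x (g i) = 0}

/-! Orthogonality of additive characters gives `|V| p^R = ∑_a S(a)`, where `S(a) = ∑_x ψ(a·g(x))`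
and `S(0) = p^s`. There are fewer than `p^R` vectors `a ≠ 0`, so it suffices that `|S(a)| ≤
p^(s-R-1)` for each of them (`norm_expSum_combination_mul_le`).

For `a ≠ 0` the forms of largest degree with nonzero coefficient make up a leading form `f` whose
singular locus has large codimension. If `f` is linear, the sum vanishes. If `f` has degree `k + 2`,
then `k + 1` Weyl differencings (`norm_expSum_pow_le`) bound `|S(a)|^(2^(k+1))` by the number of
`(k+1)`-tuples of directions that annihilate the polarized gradient of `f`. These tuples lie on a
cone in affine space of dimension `(k+1)s`. It meets the diagonal in the singular locus, because
`(k+1)!` is invertible, so `ks + D` linear forms with `D ≤ s - B` cut it down to the origin.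

The number of such tuples has to be `O(q^(ks+D))` with a constant independent of the field. By
`exists_uniform_exponent`, a Noetherian argument with generic forms over `ℤ`, the equations and
linear forms generate `N`-th powers of all variables with a uniform `N`. Hence polynomials of degree
at most `m` restrict to the cone as a space of dimension `O(m^(ks+D))`, and degree `m = O(q)`
already separates the rational points (`card_le_of_pow_mem_span`). -/

/-! ### Dimension of cones and sections by linear forms. -/

/-- Adjoining to an ideal an element that lies in no minimal prime, except possibly in maximal
ones, lowers the dimension of the quotient. -/
lemma ringKrullDim_quotient_le_of_minimalPrimes {A : Type*} [CommRing A] {I J : Ideal A} {x : A}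
    (hIJ : I ≤ J) (hx : x ∈ J) (h : ∀ P ∈ I.minimalPrimes, x ∈ P → P.IsMaximal) {D : ℕ}
    (hI : ringKrullDim (A ⧸ I) ≤ (D + 1 : ℕ)) : ringKrullDim (A ⧸ J) ≤ D := by
  rw [ringKrullDim_quotient] at hI ⊢
  refine iSup_le fun l => ?_
  have hlJ : ∀ i, J ≤ (l i).1.asIdeal := fun i => (l i).2
  obtain ⟨P, hP, hPl⟩ := Ideal.exists_minimalPrimes_le (J := l.head.1.asIdeal)
    (hIJ.trans (hlJ 0))
  by_cases hxP : x ∈ P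
  -- Nothing lies strictly above the maximal ideal `P`, so the chain is a single prime.
  · have hmax := h P hP hxP
    have h0 : l.length = 0 := by
      by_contra hne
      have hlt : l.head < l ⟨1, by omega⟩ := l.strictMono (Fin.mk_lt_mk.2 one_pos)
      have hlt' : l.head.1.asIdeal < (l ⟨1, by omega⟩).1.asIdeal := hlt
      exact (l ⟨1, by omega⟩).1.2.ne_top (hmax.1.2 _ (hPl.trans_lt hlt'))
    rw [h0]
    exact_mod_cast Nat.zero_le D
  -- Here `P` is strictly below the head, so prepending it gives a longer chain above `I`.
  · let f : PrimeSpectrum.zeroLocus (R := A) J → PrimeSpectrum.zeroLocus (R := A) I :=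
      fun p => ⟨p.1, (show (I : Set A) ⊆ p.1.asIdeal from hIJ.trans p.2)⟩
    let p' : PrimeSpectrum.zeroLocus (R := A) I := ⟨⟨P, hP.1.1⟩, hP.1.2⟩
    have hlt : p' < (l.map f (fun _ _ h => h)).head := by
      refine lt_of_le_of_ne hPl fun h => hxP ?_
      have h' : P = l.head.1.asIdeal := congrArg (fun q => q.1.asIdeal) h
      rw [h']
      exact hlJ 0 hx
    have := (Order.LTSeries.length_le_krullDim ((l.map f (fun _ _ h => h)).cons p' hlt)).trans hI
    rw [RelSeries.cons_length] at this
    have h2 : l.length + 1 ≤ D + 1 := by exact_mod_cast this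
    exact_mod_cast Nat.le_of_succ_le_succ h2

section Cones

variable {K : Type*} [Field K]

/-- Finitely many primes none of which contains all the variables can be avoided by a linear form. -/
lemma exists_linearForm_notMem {σ : Type*} [Fintype σ] [Infinite K]
    {T : Set (Ideal (MvPolynomial σ K))} (hT : T.Finite)
    (h : ∀ P ∈ T, ∃ i, (X i : MvPolynomial σ K) ∉ P) :
    ∃ c : σ → K, ∀ P ∈ T, ∑ i, C (c i) * X i ∉ P := by
  classical
  let lin : (σ → K) →ₗ[K] MvPolynomial σ K := Fintype.linearCombination K (fun i => X i)
  have hlin : ∀ c, lin c = ∑ i, C (c i) * X i := fun c => by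
    simp [lin, Fintype.linearCombination_apply, smul_eq_C_mul]
  let U : Ideal (MvPolynomial σ K) → Submodule K (σ → K) :=
    fun P => (P.restrictScalars K).comap lin
  have htop : (⊤ : Subspace K (σ → K)) ∉ hT.toFinset.image U := by
    intro hmem
    obtain ⟨P, hP, hPU⟩ := Finset.mem_image.1 hmem
    obtain ⟨i, hi⟩ := h P (hT.mem_toFinset.1 hP)
    have : Pi.single i 1 ∈ U P := by rw [hPU]; trivial
    apply hi
    have h2 : lin (Pi.single i 1) ∈ P := this
    rw [hlin, Finset.sum_eq_single i] at h2
    · simpa using h2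
    · intro b _ hb; simp [hb]
    · simp
  have hne := Subspace.biUnion_ne_univ_of_top_notMem htop
  obtain ⟨c, hc⟩ := (Set.ne_univ_iff_exists_notMem _).1 hne
  refine ⟨c, fun P hP hmem => hc ?_⟩
  refine Set.mem_iUnion₂.2 ⟨U P, Finset.mem_image_of_mem _ (hT.mem_toFinset.2 hP), ?_⟩
  change lin c ∈ P
  rwa [hlin]

/-- A cone of dimension `0` is contained in the origin. -/
lemma eq_zero_of_affineDim_le_zero [Infinite K] {s : ℕ} {Z : Set (Fin s → K)}
    (hZ : ∀ z ∈ Z, ∀ c : K, c • z ∈ Z) (hdim : affineDim Z ≤ (0 : ℕ)) {z : Fin s → K}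
    (hz : z ∈ Z) : z = 0 := by
  by_contra hne
  obtain ⟨i, hi⟩ := Function.ne_iff.1 hne
  -- Restriction to the line through `z`, which lies in the cone: a surjection onto a ring of
  -- dimension `1`.
  let φ : MvPolynomial (Fin s) K →+* Polynomial K :=
    eval₂Hom Polynomial.C (fun j => Polynomial.C (z j) * Polynomial.X)
  have hφ : ∀ P t, (φ P).eval t = eval (t • z) P := by
    intro P t
    have : (Polynomial.evalRingHom t).comp φ = eval (t • z) := by
      apply MvPolynomial.ringHom_ext
      · intro a; simp [φ]
      · intro j; simpa [φ] using mul_comm _ _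
    exact congrArg (fun f => f P) this
  have hker : ∀ P ∈ vanishingIdeal K Z, φ P = 0 := by
    intro P hP
    apply Polynomial.funext
    intro t
    rw [hφ]
    simpa [aeval_eq_eval] using hP _ (hZ z hz t)
  have hsurj : Function.Surjective φ := by
    intro q
    induction q using Polynomial.induction_on with
    | C a => exact ⟨C a, by simp [φ]⟩
    | add p q hp hq =>
      obtain ⟨a, rfl⟩ := hp; obtain ⟨b, rfl⟩ := hq; exact ⟨a + b, map_add _ _ _⟩
    | monomial n a _ =>
      refine ⟨C a * (C ((z i)⁻¹) * X i) ^ (n + 1), ?_⟩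
      have : (z i)⁻¹ * z i = 1 := inv_mul_cancel₀ hi
      simp only [φ, coe_eval₂Hom, eval₂_mul, eval₂_C, eval₂_pow, eval₂_X]
      rw [← mul_assoc, ← Polynomial.C_mul, this]; simp
  have h1 := ringKrullDim_le_of_surjective (Ideal.Quotient.lift _ φ hker)
    (Ideal.Quotient.lift_surjective_of_surjective _ hker hsurj)
  have h2 := h1.trans hdim
  rw [Polynomial.ringKrullDim_of_isNoetherianRing, ringKrullDim_eq_zero_of_field] at h2
  exact absurd h2 (by decide)

/-- A cone of dimension at most `D` is cut down to the origin by `D` linear forms. -/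
lemma exists_linearForms_of_affineDim_le [Infinite K] {s : ℕ} (D : ℕ) {Z : Set (Fin s → K)}
    (hZ : ∀ z ∈ Z, ∀ c : K, c • z ∈ Z) (hdim : affineDim Z ≤ D) :
    ∃ L : Fin D → Fin s → K, ∀ z ∈ Z, (∀ k, ∑ i, L k i * z i = 0) → z = 0 := by
  induction D generalizing Z with
  | zero => exact ⟨Fin.elim0, fun z hz _ => eq_zero_of_affineDim_le_zero hZ hdim hz⟩
  | succ D ih =>
    let I := vanishingIdeal K Z
    -- A prime containing all variables cannot be avoided by a linear form. It is the maximal ideal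
    -- of the origin, which the dimension drop tolerates.
    let T := {P ∈ I.minimalPrimes | ∃ i, (X i : MvPolynomial (Fin s) K) ∉ P}
    have hT : T.Finite :=
      (Ideal.finite_minimalPrimes_of_isNoetherianRing _ I).subset (fun P hP => hP.1)
    obtain ⟨c, hc⟩ := exists_linearForm_notMem hT (fun P hP => hP.2)
    let Z' := {z ∈ Z | ∑ i, c i * z i = 0}
    have hdim' : affineDim Z' ≤ D := by
      refine ringKrullDim_quotient_le_of_minimalPrimes (I := I) (x := ∑ i, C (c i) * X i)
        (vanishingIdeal_anti_mono fun z hz => hz.1) ?_ ?_ hdim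
      · intro z hz
        simpa using hz.2
      · intro P hP hxP
        have hall : ∀ i, (X i : MvPolynomial (Fin s) K) ∈ P := by
          by_contra! hcon
          exact hc P ⟨hP, hcon⟩ hxP
        have hPp : P.IsPrime := hP.1.1
        have hle : vanishingIdeal K {(0 : Fin s → K)} ≤ P := by
          intro q hq
          have hq0 : constantCoeff q = 0 := by
            have := hq 0 rfl
            rwa [aeval_eq_eval, eval_zero] at this
          have hmk : Ideal.Quotient.mk P = (Ideal.Quotient.mk P).comp (C.comp constantCoeff) := by
            apply MvPolynomial.ringHom_ext
            · intro a; simp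
            · intro i; simpa [Ideal.Quotient.eq_zero_iff_mem] using hall i
          rw [← Ideal.Quotient.eq_zero_iff_mem, hmk]
          simp [hq0]
        have hm : (vanishingIdeal K {(0 : Fin s → K)}).IsMaximal := inferInstance
        rwa [← hm.eq_of_le hPp.ne_top hle]
    obtain ⟨L, hL⟩ := ih (Z := Z') (fun z hz a => ⟨hZ z hz.1 a, by
      simp only [Pi.smul_apply, smul_eq_mul, mul_left_comm _ a, ← Finset.mul_sum]
      rw [hz.2, mul_zero]⟩) hdim'
    refine ⟨Fin.cons c L, fun z hz h => hL z ⟨hz, by simpa using h 0⟩ fun k => ?_⟩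
    simpa using h k.succ

/-- A cone of codimension at least `B` is cut down to the origin by `D ≤ s - B` linear forms. -/
lemma exists_linearForms_of_codimAtLeast [Infinite K] {s B : ℕ} {Z : Set (Fin s → K)}
    (hZ : ∀ z ∈ Z, ∀ c : K, c • z ∈ Z) (hne : Z.Nonempty) (hdim : CodimAtLeast Z B) :
    ∃ D, D + B ≤ s ∧
      ∃ L : Fin D → Fin s → K, ∀ z ∈ Z, (∀ k, ∑ i, L k i * z i = 0) → z = 0 := by
  -- Nonemptiness excludes the dimension `⊥`, which would not give `B ≤ s`.
  have hnt : Nontrivial (MvPolynomial (Fin s) K ⧸ vanishingIdeal K Z) := by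
    rw [Ideal.Quotient.nontrivial_iff]
    intro h
    obtain ⟨z, hz⟩ := hne
    have h1 : (1 : MvPolynomial (Fin s) K) ∈ vanishingIdeal K Z := by rw [h]; trivial
    simpa using h1 z hz
  have h0 : 0 ≤ affineDim Z := ringKrullDim_nonneg_of_nontrivial
  unfold CodimAtLeast at hdim
  obtain ⟨e, he⟩ : ∃ e : ℕ∞, affineDim Z = e := by
    cases h : affineDim Z with
    | bot => rw [h] at h0; exact absurd h0 (by decide)
    | coe e => exact ⟨e, rfl⟩
  rw [he] at hdim
  have hdim2 : e + B ≤ s := by exact_mod_cast hdim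
  lift e to ℕ using (fun h => by simp [h] at hdim2)
  exact ⟨e, by exact_mod_cast hdim2, exists_linearForms_of_affineDim_le e hZ he.le⟩

end Cones

/-! ### Uniform Nullstellensatz via generic coefficients. -/

/-- If vectors over a ring `A` become a spanning family over a field `K`, then they generate
`A ^ m` up to an element that does not vanish in `K`. -/
lemma exists_smul_mem_span_of_span_eq_top {A K m Γ : Type*} [CommRing A] [Field K] [Fintype m]
    [DecidableEq m] (φ : A →+* K) (w : Γ → m → A)
    (h : Submodule.span K (Set.range fun γ => φ ∘ w γ) = ⊤) :
    ∃ a : A, φ a ≠ 0 ∧ ∀ i, a • (Pi.single i 1 : m → A) ∈ Submodule.span A (Set.range w) := by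
  obtain ⟨κ, f, -, hspan, hli⟩ := exists_linearIndependent' K (fun γ => φ ∘ w γ)
  let b := Module.Basis.mk hli (by rw [hspan, h])
  let e : m ≃ κ := (Pi.basisFun K m).indexEquiv b
  let Q : Matrix m m A := Matrix.of fun i => w (f (e i))
  have hQ : φ Q.det ≠ 0 := by
    rw [RingHom.map_det, ← isUnit_iff_ne_zero, ← Matrix.isUnit_iff_isUnit_det,
      ← Matrix.linearIndependent_rows_iff_isUnit]
    exact hli.comp e e.injective
  refine ⟨Q.det, hQ, fun i => ?_⟩
  -- Cramer's rule: the determinant of vectors that become a basis over `K` is the required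
  -- multiplier.
  have hmul := congrFun Q.adjugate_mul i
  have : Q.det • (Pi.single i 1 : m → A) = ∑ k, Q.adjugate i k • w (f (e k)) := by
    ext j
    have := congrFun hmul j
    rw [Matrix.mul_apply] at this
    simp only [Pi.smul_apply, Finset.sum_apply, smul_eq_mul]
    rw [show ∑ c, Q.adjugate i c * w (f (e c)) j = _ from this]
    simp [Matrix.one_apply, Pi.single_apply, eq_comm]
  rw [this]
  exact Submodule.sum_mem _ fun k _ => Submodule.smul_mem _ _ (Submodule.subset_span ⟨_, rfl⟩)

/-- In `∑ c_j F_j` only the terms of `c_j` of degree `M - e j` contribute in degree `M`. This turns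
ideal membership in degree `M` into linear algebra over finitely many vectors (Macaulay's matrix).
-/
lemma coeff_monomial_mul_mem_span {σ ι K : Type*} [Field K] {e : ι → ℕ} {F : ι → MvPolynomial σ K}
    (hF : ∀ j, (F j).IsHomogeneous (e j)) {M : ℕ} {P : MvPolynomial σ K}
    (hP : P ∈ Ideal.span (Set.range F)) :
    (fun μ : {μ : σ →₀ ℕ // μ.degree = M} => coeff μ.1 P) ∈
      Submodule.span K (Set.range fun γ : Σ j, {β : σ →₀ ℕ // β.degree + e j = M} =>
        fun μ : {μ : σ →₀ ℕ // μ.degree = M} => coeff μ.1 (monomial γ.2.1 1 * F γ.1)) := by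
  set W := Submodule.span K (Set.range fun γ : Σ j, {β : σ →₀ ℕ // β.degree + e j = M} =>
        fun μ : {μ : σ →₀ ℕ // μ.degree = M} => coeff μ.1 (monomial γ.2.1 1 * F γ.1)) with hW
  let co : MvPolynomial σ K →ₗ[K] ({μ : σ →₀ ℕ // μ.degree = M} → K) :=
    LinearMap.pi fun μ => lcoeff K μ.1
  change co P ∈ W
  have key : ∀ j (Q : MvPolynomial σ K), co (Q * F j) ∈ W := by
    intro j Q
    induction Q using MvPolynomial.induction_on' with
    | monomial β c =>
      have : monomial β c * F j = c • (monomial β 1 * F j) := by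
        rw [← smul_mul_assoc, smul_monomial, smul_eq_mul, mul_one]
      rw [this, map_smul]
      refine W.smul_mem _ ?_
      by_cases hβ : β.degree + e j = M
      · exact Submodule.subset_span ⟨⟨j, β, hβ⟩, rfl⟩
      · convert W.zero_mem
        ext μ
        exact ((isHomogeneous_monomial (1 : K) rfl).mul (hF j)).coeff_eq_zero
          (fun h => hβ (by rw [← h, μ.2]))
    | add p q hp hq =>
      rw [add_mul, map_add]
      exact W.add_mem hp hq
  induction hP using Submodule.span_induction with
  | mem x hx =>
    obtain ⟨j, rfl⟩ := hx
    simpa using key j 1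
  | zero => rw [map_zero]; exact W.zero_mem
  | add x y _ _ hx hy => rw [map_add]; exact W.add_mem hx hy
  | smul a x hx _ =>
    obtain ⟨c, rfl⟩ := (Finsupp.mem_ideal_span_range_iff_exists_finsupp).1 hx
    rw [Finsupp.sum, smul_eq_mul, Finset.mul_sum, map_sum]
    refine W.sum_mem fun j _ => ?_
    rw [← mul_assoc]
    exact key _ _

section Generic

variable {σ ι : Type*} [Fintype σ]

instance (n : ℕ) : Finite {β : σ →₀ ℕ // β.degree = n} :=
  ((Finsupp.finite_of_degree_le n).subset fun β (hβ : β.degree = n) => hβ.le).to_subtype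

noncomputable instance (n : ℕ) : Fintype {β : σ →₀ ℕ // β.degree = n} := Fintype.ofFinite _

variable (σ) in
/-- The ring of the coefficients of a generic system of forms of degrees `e`. -/
abbrev GenericCoeffRing (e : ι → ℕ) : Type _ :=
  MvPolynomial (Σ j, {β : σ →₀ ℕ // β.degree = e j}) ℤ

/-- The generic form of degree `e j`. -/
noncomputable def genericForm (e : ι → ℕ) (j : ι) : MvPolynomial σ (GenericCoeffRing σ e) :=
  ∑ β : {β : σ →₀ ℕ // β.degree = e j}, monomial β.1 (X ⟨j, β⟩)

lemma isHomogeneous_genericForm (e : ι → ℕ) (j : ι) :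
    (genericForm (σ := σ) e j).IsHomogeneous (e j) :=
  IsHomogeneous.sum _ _ _ fun β _ => isHomogeneous_monomial _ β.2

variable {K : Type*} [Field K]

/-- The specialization of the generic coefficients to those of the system `F`. -/
noncomputable def specialize (e : ι → ℕ) (F : ι → MvPolynomial σ K) :
    GenericCoeffRing σ e →+* K :=
  eval₂Hom (Int.castRingHom K) fun t => coeff t.2.1 (F t.1)

lemma map_specialize_genericForm {e : ι → ℕ} {F : ι → MvPolynomial σ K}
    (hF : ∀ j, (F j).IsHomogeneous (e j)) (j : ι) :
    map (specialize e F) (genericForm e j) = F j := by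
  classical
  ext β
  simp only [genericForm, map_sum, map_monomial, coeff_sum, coeff_monomial, specialize,
    coe_eval₂Hom, eval₂_X]
  by_cases hβ : β.degree = e j
  · rw [Finset.sum_eq_single ⟨β, hβ⟩]
    · simp
    · intro b _ hb
      rw [if_neg]
      exact fun h => hb (Subtype.ext h)
    · simp
  · rw [(hF j).coeff_eq_zero hβ]
    refine Finset.sum_eq_zero fun b _ => ?_
    rw [if_neg]
    rintro rfl
    exact hβ b.2

/-- The elements of the generic coefficient ring that multiply the `N`-th powers of the variables
into the ideal generated by the generic forms. -/
noncomputable def powerColon (e : ι → ℕ) (N : ℕ) : Ideal (GenericCoeffRing σ e) where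
  carrier := {a | ∀ i : σ, C a * X i ^ N ∈ Ideal.span (Set.range (genericForm (σ := σ) e))}
  zero_mem' i := by simp
  add_mem' {a b} ha hb i := by
    rw [C_add, add_mul]
    exact Ideal.add_mem _ (ha i) (hb i)
  smul_mem' c a ha i := by
    rw [smul_eq_mul, C_mul, mul_assoc]
    exact Ideal.mul_mem_left _ _ (ha i)

lemma powerColon_mono (e : ι → ℕ) : Monotone (powerColon (σ := σ) e) := by
  refine monotone_nat_of_le_succ fun N a ha i => ?_
  rw [pow_succ, ← mul_assoc]
  exact Ideal.mul_mem_right _ _ (ha i)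

/-- Pigeonhole: some variable occurs with exponent at least `N`. -/
lemma monomial_mem_of_pow_mem {I : Ideal (MvPolynomial σ K)} {N : ℕ}
    (h : ∀ i, (X i : MvPolynomial σ K) ^ N ∈ I) {β : σ →₀ ℕ}
    (hβ : Fintype.card σ * N < β.degree) : monomial β (1 : K) ∈ I := by
  obtain ⟨i, hi⟩ : ∃ i, N ≤ β i := by
    by_contra! hcon
    apply hβ.not_ge
    rw [Finsupp.degree_eq_sum]
    simpa using Finset.sum_le_card_nsmul Finset.univ β N fun i _ => (hcon i).le
  have : monomial β (1 : K) = monomial (β - Finsupp.single i N) 1 * X i ^ N := by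
    rw [X_pow_eq_monomial, monomial_mul, mul_one, tsub_add_cancel_of_le]
    simpa using hi
  rw [this]
  exact Ideal.mul_mem_left _ _ (h i)

/-- If a specialization of the generic forms generates powers of the variables, then some element
of `powerColon` survives the specialization. -/
lemma exists_mem_powerColon {e : ι → ℕ} {F : ι → MvPolynomial σ K}
    (hF : ∀ j, (F j).IsHomogeneous (e j)) {N : ℕ}
    (h : ∀ i, (X i : MvPolynomial σ K) ^ N ∈ Ideal.span (Set.range F)) :
    ∃ M, ∃ a ∈ powerColon (σ := σ) e M, specialize e F a ≠ 0 := by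
  classical
  -- In this degree every monomial lies in the ideal, so the Macaulay vectors span after
  -- specialization.
  set M := Fintype.card σ * N + 1 with hM
  let φ := specialize e F
  let w : (Σ j, {β : σ →₀ ℕ // β.degree + e j = M}) → {μ : σ →₀ ℕ // μ.degree = M} →
    GenericCoeffRing σ e := fun γ μ => coeff μ.1 (monomial γ.2.1 1 * genericForm e γ.1)
  have hw : ∀ γ, φ ∘ w γ = fun μ => coeff μ.1 (monomial γ.2.1 1 * F γ.1) := by
    intro γ
    ext μ
    simp only [Function.comp, w]
    rw [← coeff_map, map_mul, map_specialize_genericForm hF, map_monomial, map_one]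
  have hspan : Submodule.span K (Set.range fun γ => φ ∘ w γ) = ⊤ := by
    simp_rw [hw]
    rw [eq_top_iff, ← (Pi.basisFun K _).span_eq, Submodule.span_le]
    rintro _ ⟨μ, rfl⟩
    have := coeff_monomial_mul_mem_span hF (M := M)
      (monomial_mem_of_pow_mem h (β := μ.1) (by rw [μ.2]; omega))
    rw [SetLike.mem_coe]
    convert this using 1
    ext ν
    simp [coeff_monomial, Pi.single_apply, Subtype.ext_iff, eq_comm]
  obtain ⟨a, ha, hmem⟩ := exists_smul_mem_span_of_span_eq_top φ w hspan
  refine ⟨M, a, fun i => ?_, ha⟩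
  -- `back` rebuilds a form of degree `M` from its coefficients; it carries the linear relations
  -- over the generic ring back to the generic ideal.
  let back : ({μ : σ →₀ ℕ // μ.degree = M} → GenericCoeffRing σ e) →ₗ[GenericCoeffRing σ e]
    MvPolynomial σ (GenericCoeffRing σ e) :=
    Fintype.linearCombination _ fun μ => monomial μ.1 1
  have hback : ∀ P : MvPolynomial σ (GenericCoeffRing σ e), P.IsHomogeneous M →
      back (fun μ => coeff μ.1 P) = P := by
    intro P hP
    ext ν : 1
    simp only [back, Fintype.linearCombination_apply, coeff_sum, coeff_smul, coeff_monomial]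
    by_cases hν : ν.degree = M
    · rw [Finset.sum_eq_single ⟨ν, hν⟩]
      · simp
      · intro b _ hb
        rw [if_neg (fun h => hb (Subtype.ext h)), smul_zero]
      · simp
    · rw [hP.coeff_eq_zero hν]
      refine Finset.sum_eq_zero fun b _ => ?_
      rw [if_neg (by rintro rfl; exact hν b.2), smul_zero]
  have hle : Submodule.span _ (Set.range w) ≤
      ((Ideal.span (Set.range (genericForm (σ := σ) e))).restrictScalars
        (GenericCoeffRing σ e)).comap back := by
    rw [Submodule.span_le]
    rintro _ ⟨γ, rfl⟩
    change back (w γ) ∈ Ideal.span _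
    rw [hback _ (by
      have := (isHomogeneous_monomial (σ := σ) (1 : GenericCoeffRing σ e) rfl).mul
        (isHomogeneous_genericForm e γ.1) (φ := monomial γ.2.1 1)
      rwa [γ.2.2] at this)]
    exact Ideal.mul_mem_left _ _ (Ideal.subset_span ⟨_, rfl⟩)
  have h1 : back (a • Pi.single ⟨Finsupp.single i M, by simp⟩ 1) ∈
      Ideal.span (Set.range (genericForm (σ := σ) e)) :=
    hle (hmem ⟨Finsupp.single i M, by simp⟩)
  rw [map_smul, show back (Pi.single _ 1) = _ from
    Fintype.linearCombination_apply_single _ _ _ _, one_smul, smul_eq_C_mul,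
    ← X_pow_eq_monomial] at h1
  exact h1

/-- Uniform Nullstellensatz: for systems of forms of given degrees that generate powers of all the
variables, the exponent can be chosen independently of the field and of the coefficients. -/
theorem exists_uniform_exponent (σ : Type*) {ι : Type*} [Fintype σ] [Finite ι] (e : ι → ℕ) :
    ∃ N : ℕ, ∀ (K : Type) [Field K] (F : ι → MvPolynomial σ K),
      (∀ j, (F j).IsHomogeneous (e j)) →
      (∃ N', ∀ i, (X i : MvPolynomial σ K) ^ N' ∈ Ideal.span (Set.range F)) →
      ∀ i, (X i : MvPolynomial σ K) ^ N ∈ Ideal.span (Set.range F) := by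
  -- The multiplier `a` depends on the field and on `F`, but the chain of ideals containing it
  -- stabilizes at an `N` that depends only on `e`.
  obtain ⟨N, hN⟩ := monotone_stabilizes_iff_noetherian.2
    (inferInstance : IsNoetherian (GenericCoeffRing σ e) (GenericCoeffRing σ e))
    ⟨powerColon (σ := σ) e, powerColon_mono e⟩
  refine ⟨N, fun K _ F hF ⟨N', h⟩ i => ?_⟩
  obtain ⟨M, a, ha, hne⟩ := exists_mem_powerColon hF h
  have haN : a ∈ powerColon (σ := σ) e N := by
    rcases le_total M N with hMN | hMN
    · exact powerColon_mono e hMN ha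
    · have := hN M hMN
      simp only [OrderHom.coe_mk] at this
      rwa [this]
  have h1 := Ideal.mem_map_of_mem (map (specialize e F)) (haN i)
  rw [Ideal.map_span, ← Set.range_comp] at h1
  have h2 : ⇑(map (specialize e F)) ∘ genericForm (σ := σ) e = F :=
    funext fun j => map_specialize_genericForm hF j
  rw [h2, map_mul, map_C, map_pow, map_X] at h1
  have h3 := Ideal.mul_mem_left _ (C (specialize e F a)⁻¹) h1
  rwa [← mul_assoc, ← C_mul, inv_mul_cancel₀ hne, C_1, one_mul] at h3

end Generic

/-! ### Hilbert function bound for points of a cone in a grid. -/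

section HilbertFunction

variable {σ ι Λ K : Type*} [Field K]

lemma homogeneousComponent_mul_of_isHomogeneous {G : MvPolynomial σ K} {e : ℕ}
    (hG : G.IsHomogeneous e) (c : MvPolynomial σ K) (N : ℕ) :
    homogeneousComponent N (c * G) = if e ≤ N then homogeneousComponent (N - e) c * G else 0 := by
  have h1 : ∀ i, homogeneousComponent N (homogeneousComponent i c * G) =
      if N = i + e then homogeneousComponent i c * G else 0 := fun i =>
    homogeneousComponent_of_mem ((homogeneousComponent_isHomogeneous i c).mul hG)
  conv_lhs => rw [← sum_homogeneousComponent c, Finset.sum_mul, map_sum]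
  simp_rw [h1]
  split_ifs with he
  · by_cases hle : N - e ≤ c.totalDegree
    · rw [Finset.sum_eq_single (N - e)]
      · rw [if_pos (by omega)]
      · intro i _ hi
        rw [if_neg (by omega)]
      · intro h
        exact absurd (Finset.mem_range.2 (by omega)) h
    · rw [homogeneousComponent_eq_zero _ _ (by omega), zero_mul]
      refine Finset.sum_eq_zero fun i hi => ?_
      rw [if_neg]
      have := Finset.mem_range.1 hi
      omega
  · exact Finset.sum_eq_zero fun i _ => if_neg (by omega)

variable [Fintype σ] [Fintype Λ]

/-- The linear form with coefficient vector `c`. -/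
noncomputable def linearForm (c : σ → K) : MvPolynomial σ K := ∑ i, C (c i) * X i

lemma isHomogeneous_linearForm (c : σ → K) : (linearForm c).IsHomogeneous 1 :=
  IsHomogeneous.sum _ _ _ fun _ _ => isHomogeneous_C_mul_X _ _

lemma eval_linearForm (c z : σ → K) : eval z (linearForm c) = ∑ i, c i * z i := by
  simp [linearForm]

/-- Taking components of degree `N` keeps the `F`-part in the ideal and leaves cofactors of the
linear forms of degree at most `N - 1`. This degree drop drives the induction in
`mem_hilbertSpan_of_totalDegree_le`. -/
lemma exists_pow_sub_mem_span [Fintype ι] {e : ι → ℕ} {F : ι → MvPolynomial σ K}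
    (hF : ∀ j, (F j).IsHomogeneous (e j)) {ℓ : Λ → σ → K} {N : ℕ} (hN : 1 ≤ N) {i : σ}
    (h : X i ^ N ∈ Ideal.span (Set.range (Sum.elim F fun k => linearForm (ℓ k)))) :
    ∃ b : Λ → MvPolynomial σ K, (∀ k, (b k).totalDegree ≤ N - 1) ∧
      X i ^ N - ∑ k, linearForm (ℓ k) * b k ∈ Ideal.span (Set.range F) := by
  obtain ⟨c, hc⟩ := Ideal.mem_span_range_iff_exists_fun.1 h
  refine ⟨fun k => homogeneousComponent (N - 1) (c (Sum.inr k)),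
    fun k => (homogeneousComponent_isHomogeneous _ _).totalDegree_le, ?_⟩
  have h1 := congrArg (homogeneousComponent N) hc
  rw [homogeneousComponent_eq_self (isHomogeneous_X_pow i N), Fintype.sum_sum_type, map_add,
    map_sum, map_sum] at h1
  simp only [Sum.elim_inl, Sum.elim_inr] at h1
  simp_rw [homogeneousComponent_mul_of_isHomogeneous (isHomogeneous_linearForm _), if_pos hN,
    homogeneousComponent_mul_of_isHomogeneous (hF _)] at h1
  rw [← h1]
  simp_rw [mul_comm (linearForm _)]
  rw [add_sub_cancel_right]
  refine Ideal.sum_mem _ fun j _ => ?_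
  split_ifs
  · exact Ideal.mul_mem_left _ _ (Ideal.subset_span ⟨j, rfl⟩)
  · exact Ideal.zero_mem _

/-- The span, modulo the ideal generated by `F`, of the products of a monomial with exponents below
`N` and of a product of linear forms with exponents at most `m`. -/
noncomputable def hilbertSpan (F : ι → MvPolynomial σ K) (ℓ : Λ → σ → K) (N m : ℕ) :
    Submodule K (MvPolynomial σ K) :=
  (Ideal.span (Set.range F)).restrictScalars K ⊔
    Submodule.span K (Set.range fun p : (σ → Fin N) × (Λ → Fin (m + 1)) =>
      (∏ i, X i ^ (p.1 i : ℕ)) * ∏ k, linearForm (ℓ k) ^ (p.2 k : ℕ))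

lemma mem_hilbertSpan_of_mem_span {F : ι → MvPolynomial σ K} (ℓ : Λ → σ → K) (N m : ℕ)
    {P : MvPolynomial σ K} (hP : P ∈ Ideal.span (Set.range F)) : P ∈ hilbertSpan F ℓ N m :=
  (le_sup_left : _ ≤ hilbertSpan F ℓ N m) hP

lemma linearForm_mul_mem_hilbertSpan {F : ι → MvPolynomial σ K} {ℓ : Λ → σ → K} {N m : ℕ}
    {P : MvPolynomial σ K} (hP : P ∈ hilbertSpan F ℓ N m) (k : Λ) :
    linearForm (ℓ k) * P ∈ hilbertSpan F ℓ N (m + 1) := by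
  classical
  suffices h : hilbertSpan F ℓ N m ≤
      (hilbertSpan F ℓ N (m + 1)).comap (LinearMap.mulLeft K (linearForm (ℓ k))) from h hP
  refine sup_le (fun Q hQ => mem_hilbertSpan_of_mem_span _ _ _ (Ideal.mul_mem_left _ _ hQ)) ?_
  rw [Submodule.span_le]
  rintro _ ⟨p, rfl⟩
  refine (le_sup_right : _ ≤ hilbertSpan F ℓ N (m + 1)) (Submodule.subset_span
    ⟨(p.1, fun k' => if k' = k then (p.2 k').succ else (p.2 k').castSucc), ?_⟩)
  have h1 : ∀ k', linearForm (ℓ k') ^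
      ((if k' = k then (p.2 k').succ else (p.2 k').castSucc : Fin (m + 1 + 1)) : ℕ) =
      (if k' = k then linearForm (ℓ k') else 1) * linearForm (ℓ k') ^ (p.2 k' : ℕ) := by
    intro k'
    split_ifs
    · rw [Fin.val_succ, pow_succ']
    · rw [Fin.val_castSucc, one_mul]
  simp only [LinearMap.mulLeft_apply, h1, Finset.prod_mul_distrib, Finset.prod_ite_eq',
    Finset.mem_univ, if_true]
  ring

/-- A monomial with all exponents below `N` is a generator. In any other, a factor `X i ^ N` is
traded, modulo the ideal, for linear forms times polynomials of smaller degree. -/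
lemma mem_hilbertSpan_of_totalDegree_le [Fintype ι] {e : ι → ℕ} {F : ι → MvPolynomial σ K}
    (hF : ∀ j, (F j).IsHomogeneous (e j)) {ℓ : Λ → σ → K} {N : ℕ} (hN : 1 ≤ N)
    (h : ∀ i, X i ^ N ∈ Ideal.span (Set.range (Sum.elim F fun k => linearForm (ℓ k)))) (m : ℕ)
    {P : MvPolynomial σ K} (hP : P.totalDegree ≤ m) : P ∈ hilbertSpan F ℓ N m := by
  induction m using Nat.strong_induction_on generalizing P with
  | _ m ih =>
    rw [P.as_sum]
    refine Submodule.sum_mem _ fun μ hμ => ?_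
    rw [← mul_one (coeff μ P), ← smul_eq_mul, ← smul_monomial]
    refine Submodule.smul_mem _ _ ?_
    have hdeg : μ.degree ≤ m := by
      refine le_trans ?_ hP
      exact le_totalDegree hμ
    by_cases hlt : ∀ i, μ i < N
    · refine (le_sup_right : _ ≤ hilbertSpan F ℓ N m) (Submodule.subset_span
        ⟨(fun i => ⟨μ i, hlt i⟩, fun _ => 0), ?_⟩)
      rw [monomial_eq]
      simp [Finsupp.prod_fintype]
    · push Not at hlt
      obtain ⟨i, hi⟩ := hlt
      have hNμ : N + (μ - Finsupp.single i N).degree = μ.degree := by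
        conv_rhs => rw [← tsub_add_cancel_of_le (show Finsupp.single i N ≤ μ by simpa using hi)]
        rw [map_add, Finsupp.degree_single, add_comm]
      have hmon : monomial μ (1 : K) = X i ^ N * monomial (μ - Finsupp.single i N) 1 := by
        rw [X_pow_eq_monomial, monomial_mul, mul_one, add_tsub_cancel_of_le]
        simpa using hi
      obtain ⟨b, hb, hmem⟩ := exists_pow_sub_mem_span hF hN (h i)
      obtain ⟨m, rfl⟩ : ∃ m', m = m' + 1 := ⟨m - 1, by omega⟩
      have hsplit : monomial μ (1 : K) =
          (X i ^ N - ∑ k, linearForm (ℓ k) * b k) * monomial (μ - Finsupp.single i N) 1 +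
          ∑ k, linearForm (ℓ k) * (b k * monomial (μ - Finsupp.single i N) 1) := by
        rw [hmon, sub_mul, Finset.sum_mul]
        simp_rw [mul_assoc]
        ring
      rw [hsplit]
      refine Submodule.add_mem _
        (mem_hilbertSpan_of_mem_span _ _ _ (Ideal.mul_mem_right _ _ hmem)) ?_
      refine Submodule.sum_mem _ fun k _ => linearForm_mul_mem_hilbertSpan (ih m (by omega) ?_) k
      have h1 := totalDegree_mul (b k) (monomial (μ - Finsupp.single i N) (1 : K))
      have h2 : (monomial (μ - Finsupp.single i N) (1 : K)).totalDegree =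
          (μ - Finsupp.single i N).degree := totalDegree_monomial _ one_ne_zero
      have h3 := hb k
      omega

/-- Interpolation: a point of the grid `A ^ σ` is separated from the rest of the grid by a
polynomial of degree at most `|σ| * |A|`. -/
lemma exists_separating_polynomial (A : Finset K) (a : σ → K) :
    ∃ P : MvPolynomial σ K, P.totalDegree ≤ Fintype.card σ * A.card ∧ eval a P ≠ 0 ∧
      ∀ b : σ → K, (∀ i, b i ∈ A) → b ≠ a → eval b P = 0 := by
  classical
  refine ⟨∏ i, ∏ c ∈ A.erase (a i), (X i - C c), ?_, ?_, ?_⟩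
  · refine (totalDegree_finsetProd _ _).trans ?_
    rw [← smul_eq_mul, ← Finset.card_univ]
    refine Finset.sum_le_card_nsmul _ _ _ fun i _ => ?_
    refine (totalDegree_finsetProd _ _).trans ?_
    refine (Finset.sum_le_card_nsmul _ _ 1 fun c _ => ?_).trans ?_
    · refine (totalDegree_sub _ _).trans ?_
      simp
    · rw [smul_eq_mul, mul_one]
      exact Finset.card_le_card (Finset.erase_subset _ _)
  · simp only [map_prod, Finset.prod_ne_zero_iff]
    intro i _ c hc
    simpa [sub_eq_zero] using (Finset.ne_of_mem_erase hc).symm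
  · intro b hb hne
    obtain ⟨i, hi⟩ := Function.ne_iff.1 hne
    rw [map_prod]
    refine Finset.prod_eq_zero (Finset.mem_univ i) ?_
    rw [map_prod]
    exact Finset.prod_eq_zero (Finset.mem_erase.2 ⟨hi, hb i⟩) (by simp)

/-- A cone that is cut down to the origin by `|Λ|` linear forms has `O(q ^ |Λ|)` points in a grid
of side `q`. -/
theorem card_le_of_pow_mem_span [Fintype ι] {e : ι → ℕ} {F : ι → MvPolynomial σ K}
    (hF : ∀ j, (F j).IsHomogeneous (e j)) {ℓ : Λ → σ → K} {N : ℕ} (hN : 1 ≤ N)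
    (h : ∀ i, X i ^ N ∈ Ideal.span (Set.range (Sum.elim F fun k => linearForm (ℓ k))))
    (A : Finset K) (S : Finset (σ → K)) (hSA : ∀ a ∈ S, ∀ i, a i ∈ A)
    (hSF : ∀ a ∈ S, ∀ j, eval a (F j) = 0) :
    S.card ≤ N ^ Fintype.card σ * (Fintype.card σ * A.card + 1) ^ Fintype.card Λ := by
  classical
  set m := Fintype.card σ * A.card with hm
  let ev : MvPolynomial σ K →ₗ[K] (S → K) := LinearMap.pi fun a => (aeval a.1).toLinearMap
  have hev : ∀ P a, ev P a = eval a.1 P := fun P a => by simp [ev, aeval_eq_eval]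
  let gen : (σ → Fin N) × (Λ → Fin (m + 1)) → MvPolynomial σ K := fun p =>
    (∏ i, X i ^ (p.1 i : ℕ)) * ∏ k, linearForm (ℓ k) ^ (p.2 k : ℕ)
  have hle : (hilbertSpan F ℓ N m).map ev ≤ Submodule.span K (Set.range fun p => ev (gen p)) := by
    rw [hilbertSpan, Submodule.map_sup]
    refine sup_le ?_ ?_
    · rintro _ ⟨P, hP, rfl⟩
      have hzero : ev P = 0 := by
        ext a
        rw [hev]
        have hker : Ideal.span (Set.range F) ≤ RingHom.ker (eval a.1) := by
          rw [Ideal.span_le]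
          rintro _ ⟨j, rfl⟩
          exact hSF a.1 a.2 j
        exact hker hP
      rw [hzero]
      exact Submodule.zero_mem _
    · rw [Submodule.map_span, ← Set.range_comp]
      exact le_rfl
  have htop : Submodule.span K (Set.range fun p => ev (gen p)) = ⊤ := by
    rw [eq_top_iff, ← (Pi.basisFun K S).span_eq, Submodule.span_le]
    rintro _ ⟨a, rfl⟩
    obtain ⟨P, hPdeg, hPa, hPb⟩ := exists_separating_polynomial A a.1
    have h1 : ev P ∈ Submodule.span K (Set.range fun p => ev (gen p)) :=
      hle ⟨P, mem_hilbertSpan_of_totalDegree_le hF hN h m hPdeg, rfl⟩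
    have h2 : (Pi.basisFun K S) a = (eval a.1 P)⁻¹ • ev P := by
      ext b
      rw [Pi.basisFun_apply, Pi.smul_apply, hev, smul_eq_mul]
      by_cases hba : b = a
      · subst hba
        rw [Pi.single_eq_same, inv_mul_cancel₀ hPa]
      · rw [Pi.single_eq_of_ne hba, hPb b.1 (hSA b.1 b.2) (fun h => hba (Subtype.ext h)), mul_zero]
    rw [h2]
    exact Submodule.smul_mem _ _ h1
  -- The functions on `S` are spanned by the evaluated generators, so `|S|` is at most their number.
  have h3 := finrank_range_le_card (R := K) fun p => ev (gen p)
  rw [Set.finrank, htop, finrank_top, Module.finrank_fintype_fun_eq_card] at h3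
  simpa using h3

end HilbertFunction

/-! ### Directional derivatives and first-order Taylor expansion. -/

section DirectionalDerivative

variable {σ R : Type*} [CommRing R]

variable (σ R) in
/-- The polynomials of degree less than `n`. -/
noncomputable def degreeLTSubmodule (n : ℕ) : Submodule R (MvPolynomial σ R) :=
  restrictSupport R {μ | μ.degree < n}

lemma degreeLTSubmodule_mono : Monotone (degreeLTSubmodule σ R) := fun _ _ h =>
  restrictSupport_mono R fun _ hμ => lt_of_lt_of_le hμ h

lemma eq_zero_of_mem_degreeLTSubmodule_zero {P : MvPolynomial σ R}
    (hP : P ∈ degreeLTSubmodule σ R 0) : P = 0 := by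
  rw [← support_eq_empty, Finset.eq_empty_iff_forall_notMem]
  intro μ hμ
  exact absurd (((mem_restrictSupport_iff R).1 hP) hμ) (Nat.not_lt_zero _)

lemma eq_C_of_mem_degreeLTSubmodule_one {P : MvPolynomial σ R}
    (hP : P ∈ degreeLTSubmodule σ R 1) : P = C (constantCoeff P) := by
  rw [constantCoeff_eq, ← totalDegree_eq_zero_iff_eq_C, totalDegree_eq_zero_iff]
  intro μ hμ i
  have h : μ.degree < 1 := ((mem_restrictSupport_iff R).1 hP) hμ
  rw [Nat.lt_one_iff, Finsupp.degree_eq_zero_iff] at h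
  rw [h]; rfl

lemma MvPolynomial.IsHomogeneous.mem_degreeLTSubmodule {P : MvPolynomial σ R} {m n : ℕ}
    (hP : P.IsHomogeneous m) (h : m < n) : P ∈ degreeLTSubmodule σ R n := by
  rw [degreeLTSubmodule, mem_restrictSupport_iff]
  intro μ hμ
  by_contra hcon
  refine mem_support_iff.1 hμ (hP.coeff_eq_zero fun h' => hcon ?_)
  rw [← h'] at h
  exact h

lemma degreeLTSubmodule_le {n : ℕ} {W : Submodule R (MvPolynomial σ R)}
    (h : ∀ μ : σ →₀ ℕ, μ.degree < n → monomial μ 1 ∈ W) : degreeLTSubmodule σ R n ≤ W := by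
  rw [degreeLTSubmodule, restrictSupport_eq_span, Submodule.span_le]
  rintro _ ⟨μ, hμ, rfl⟩
  exact h μ hμ

/-- The alternative `m = 0`, where `P = 0`, serves the truncated `n - 1` in
`translatePoly_sub_dirDeriv_mem`. -/
lemma X_mul_mem_degreeLTSubmodule {P : MvPolynomial σ R} {m n : ℕ}
    (hP : P ∈ degreeLTSubmodule σ R m) (h : m = 0 ∨ m + 1 ≤ n) (i : σ) :
    X i * P ∈ degreeLTSubmodule σ R n := by
  rcases h with rfl | h
  · rw [eq_zero_of_mem_degreeLTSubmodule_zero hP, mul_zero]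
    exact Submodule.zero_mem _
  · suffices h' : degreeLTSubmodule σ R m ≤
        (degreeLTSubmodule σ R n).comap (LinearMap.mulLeft R (X i)) from h' hP
    refine degreeLTSubmodule_le fun μ hμ => ?_
    refine IsHomogeneous.mem_degreeLTSubmodule
      ((isHomogeneous_X R i).mul (isHomogeneous_monomial 1 rfl)) ?_
    omega

/-- The derivative in the direction `h`. -/
noncomputable def dirDeriv (h : σ → R) : Derivation R (MvPolynomial σ R) (MvPolynomial σ R) :=
  mkDerivation R fun i => C (h i)

@[simp]
lemma dirDeriv_X (h : σ → R) (i : σ) : dirDeriv h (X i) = C (h i) := mkDerivation_X _ _ _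

lemma pderiv_eq_dirDeriv [DecidableEq σ] (j : σ) (P : MvPolynomial σ R) :
    pderiv j P = dirDeriv (Pi.single j 1) P := by
  refine congrArg (fun D : Derivation R _ _ => D P) (derivation_ext fun i => ?_)
  rw [dirDeriv_X, pderiv_X, Pi.single_apply, Pi.single_apply]
  simp only [apply_ite C, C_1, C_0]

lemma dirDeriv_comm (h h' : σ → R) (P : MvPolynomial σ R) :
    dirDeriv h (dirDeriv h' P) = dirDeriv h' (dirDeriv h P) := by
  have : ⁅dirDeriv h, dirDeriv h'⁆ = 0 := derivation_ext fun i => by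
    simp [Derivation.commutator_apply]
  rw [← sub_eq_zero, ← Derivation.commutator_apply, this, Derivation.zero_apply]

lemma dirDeriv_pderiv (h : σ → R) (j : σ) (P : MvPolynomial σ R) :
    dirDeriv h (pderiv j P) = pderiv j (dirDeriv h P) := by
  classical
  rw [pderiv_eq_dirDeriv, pderiv_eq_dirDeriv, dirDeriv_comm]

lemma dirDeriv_eq_sum [Fintype σ] (h : σ → R) (P : MvPolynomial σ R) :
    dirDeriv h P = ∑ i, C (h i) * pderiv i P := by
  classical
  have : dirDeriv h = ∑ i, (C (h i) : MvPolynomial σ R) • pderiv i := derivation_ext fun j => by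
    rw [dirDeriv_X, ← Derivation.coeFnAddMonoidHom_apply, map_sum, Finset.sum_apply]
    simp [Derivation.coeFnAddMonoidHom_apply, Derivation.smul_apply, pderiv_X, Pi.single_apply]
  rw [this, ← Derivation.coeFnAddMonoidHom_apply, map_sum, Finset.sum_apply]
  rfl

lemma map_dirDeriv [Fintype σ] {R' : Type*} [CommRing R'] (φ : R →+* R') (h : σ → R)
    (P : MvPolynomial σ R) : map φ (dirDeriv h P) = dirDeriv (φ ∘ h) (map φ P) := by
  simp [dirDeriv_eq_sum, pderiv_map]

lemma dirDeriv_mem_degreeLTSubmodule (h : σ → R) {P : MvPolynomial σ R} {n : ℕ}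
    (hP : P ∈ degreeLTSubmodule σ R (n + 1)) : dirDeriv h P ∈ degreeLTSubmodule σ R n := by
  suffices h' : degreeLTSubmodule σ R (n + 1) ≤
      (degreeLTSubmodule σ R n).comap (dirDeriv h).toLinearMap from h' hP
  refine degreeLTSubmodule_le fun μ hμ => ?_
  change dirDeriv h (monomial μ 1) ∈ degreeLTSubmodule σ R n
  rw [dirDeriv, mkDerivation_monomial, one_smul]
  refine Submodule.sum_mem _ fun i hi => ?_
  refine IsHomogeneous.mem_degreeLTSubmodule
    ((isHomogeneous_monomial _ rfl).mul (isHomogeneous_C _ _)) ?_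
  have h1 : Finsupp.single i 1 ≤ μ := by
    simpa using Nat.one_le_iff_ne_zero.2 (Finsupp.mem_support_iff.1 hi)
  have h2 : μ.degree = (μ - Finsupp.single i 1).degree + 1 := by
    conv_lhs => rw [← tsub_add_cancel_of_le h1]
    rw [map_add, Finsupp.degree_single]
  omega

/-- The translate of a polynomial by `h`. -/
noncomputable def translatePoly (h : σ → R) : MvPolynomial σ R →ₐ[R] MvPolynomial σ R :=
  aeval fun i => X i + C (h i)

lemma eval_translatePoly (h x : σ → R) (P : MvPolynomial σ R) :
    eval x (translatePoly h P) = eval (x + h) P := by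
  have : (eval x).comp (translatePoly h).toRingHom = eval (x + h) := by
    apply MvPolynomial.ringHom_ext
    · intro a; simp [translatePoly]
    · intro i; simp [translatePoly]
  exact congrArg (fun f => f P) this

/-- Taylor expansion to first order. -/
lemma translatePoly_sub_dirDeriv_mem (h : σ → R) {P : MvPolynomial σ R} {n : ℕ}
    (hP : P ∈ degreeLTSubmodule σ R (n + 1)) :
    translatePoly h P - P - dirDeriv h P ∈ degreeLTSubmodule σ R (n - 1) := by
  let r : MvPolynomial σ R →ₗ[R] MvPolynomial σ R :=
    (translatePoly h).toLinearMap - LinearMap.id - (dirDeriv h).toLinearMap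
  change r P ∈ _
  have hr : ∀ Q, r Q = translatePoly h Q - Q - dirDeriv h Q := fun _ => rfl
  have key : ∀ (n : ℕ) (μ : σ →₀ ℕ), μ.degree = n →
      r (monomial μ 1) ∈ degreeLTSubmodule σ R (n - 1) := by
    intro n
    induction n with
    | zero =>
      intro μ hμ
      rw [Finsupp.degree_eq_zero_iff] at hμ
      subst hμ
      have : r (monomial 0 1) = 0 := by
        rw [hr, show monomial (0 : σ →₀ ℕ) (1 : R) = 1 from rfl]
        simp
      rw [this]
      exact Submodule.zero_mem _
    | succ n ih =>
      intro μ hμ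
      obtain ⟨i, hi⟩ : ∃ i, i ∈ μ.support := by
        by_contra! hcon
        rw [← Finset.eq_empty_iff_forall_notMem, Finsupp.support_eq_empty] at hcon
        rw [hcon] at hμ
        simp at hμ
      have h1 : Finsupp.single i 1 ≤ μ := by
        simpa using Nat.one_le_iff_ne_zero.2 (Finsupp.mem_support_iff.1 hi)
      obtain ⟨ν, rfl⟩ : ∃ ν, μ = Finsupp.single i 1 + ν := ⟨_, (add_tsub_cancel_of_le h1).symm⟩
      have hν : ν.degree = n := by
        rw [map_add, Finsupp.degree_single] at hμ
        omega
      have hmul : monomial (Finsupp.single i 1 + ν) (1 : R) = X i * monomial ν 1 := by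
        rw [X, monomial_mul, one_mul]
      have hexp : r (X i * monomial ν 1) = X i * r (monomial ν 1) +
          h i • dirDeriv h (monomial ν 1) + h i • r (monomial ν 1) := by
        rw [hr, hr, map_mul, Derivation.leibniz, dirDeriv_X]
        simp only [translatePoly, aeval_X, smul_eq_mul, smul_eq_C_mul]
        ring
      rw [hmul, hexp]
      have hrν := ih ν hν
      refine Submodule.add_mem _ (Submodule.add_mem _ ?_ ?_) ?_
      · exact X_mul_mem_degreeLTSubmodule hrν (by omega) i
      · refine Submodule.smul_mem _ _ (dirDeriv_mem_degreeLTSubmodule h ?_)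
        exact (isHomogeneous_monomial _ hν).mem_degreeLTSubmodule (by omega)
      · exact Submodule.smul_mem _ _ (degreeLTSubmodule_mono (by omega) hrν)
  suffices h' : degreeLTSubmodule σ R (n + 1) ≤ (degreeLTSubmodule σ R (n - 1)).comap r from h' hP
  exact degreeLTSubmodule_le fun μ hμ => degreeLTSubmodule_mono (by omega) (key _ μ rfl)

lemma translatePoly_sub_mem {n : ℕ} {f : MvPolynomial σ R} (hf : f ∈ degreeLTSubmodule σ R (n + 1))
    (h : σ → R) : translatePoly h f - f ∈ degreeLTSubmodule σ R n := by
  have h1 := degreeLTSubmodule_mono (Nat.sub_le n 1) (translatePoly_sub_dirDeriv_mem h hf)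
  have h2 := Submodule.add_mem _ h1 (dirDeriv_mem_degreeLTSubmodule h hf)
  rwa [sub_add_cancel] at h2

/-- The iterated directional derivative in the directions `h 0, …, h (k - 1)`. -/
noncomputable def iterDirDeriv :
    {k : ℕ} → (Fin k → σ → R) → (MvPolynomial σ R →ₗ[R] MvPolynomial σ R)
  | 0, _ => LinearMap.id
  | _ + 1, h => iterDirDeriv (Fin.tail h) ∘ₗ (dirDeriv (h 0)).toLinearMap

lemma iterDirDeriv_zero (h : Fin 0 → σ → R) (P : MvPolynomial σ R) : iterDirDeriv h P = P := rfl

lemma iterDirDeriv_succ {k : ℕ} (h : Fin (k + 1) → σ → R) (P : MvPolynomial σ R) :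
    iterDirDeriv h P = iterDirDeriv (Fin.tail h) (dirDeriv (h 0) P) := rfl

lemma iterDirDeriv_cons {k : ℕ} (h₀ : σ → R) (h : Fin k → σ → R) (P : MvPolynomial σ R) :
    iterDirDeriv (Fin.cons h₀ h : Fin (k + 1) → σ → R) P = iterDirDeriv h (dirDeriv h₀ P) := by
  rw [iterDirDeriv_succ, Fin.cons_zero, Fin.tail_cons]

lemma iterDirDeriv_eq_zero {k : ℕ} (h : Fin k → σ → R) {P : MvPolynomial σ R}
    (hP : P ∈ degreeLTSubmodule σ R k) : iterDirDeriv h P = 0 := by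
  induction k generalizing P with
  | zero => exact eq_zero_of_mem_degreeLTSubmodule_zero hP
  | succ k ih => exact ih _ (dirDeriv_mem_degreeLTSubmodule _ hP)

lemma iterDirDeriv_pderiv_eq_zero {k : ℕ} (h : Fin k → σ → R) (j : σ) {P : MvPolynomial σ R}
    (hP : P ∈ degreeLTSubmodule σ R (k + 1)) : iterDirDeriv h (pderiv j P) = 0 := by
  classical
  rw [pderiv_eq_dirDeriv]
  exact iterDirDeriv_eq_zero h (dirDeriv_mem_degreeLTSubmodule _ hP)

lemma map_iterDirDeriv [Fintype σ] {R' : Type*} [CommRing R'] (φ : R →+* R') {k : ℕ}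
    (h : Fin k → σ → R) (P : MvPolynomial σ R) :
    map φ (iterDirDeriv h P) = iterDirDeriv (fun t => φ ∘ h t) (map φ P) := by
  induction k generalizing P with
  | zero => rfl
  | succ k ih => rw [iterDirDeriv_succ, ih, map_dirDeriv]; rfl

end DirectionalDerivative

/-! ### Weyl differencing. -/

section Weyl

variable {σ F : Type*} [Fintype σ] [DecidableEq σ] [Field F] [Fintype F]

/-- The exponential sum of the polynomial `f`. -/
noncomputable def expSum (ψ : AddChar F ℂ) (f : MvPolynomial σ F) : ℂ :=
  ∑ x : σ → F, ψ (eval x f)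

lemma norm_expSum_le (ψ : AddChar F ℂ) (f : MvPolynomial σ F) :
    ‖expSum ψ f‖ ≤ Fintype.card F ^ Fintype.card σ := by
  refine (norm_sum_le _ _).trans ?_
  simp [AddChar.norm_apply]

/-- Translating along the `j`-th axis shifts `f` by a constant `a` with `ψ a ≠ 1`, so the sum equals
itself times `ψ a`. -/
lemma expSum_eq_zero {ψ : AddChar F ℂ} (hψ : ψ ≠ 0) {f : MvPolynomial σ F}
    (hf : f ∈ degreeLTSubmodule σ F 2) {j : σ} (hj : constantCoeff (pderiv j f) ≠ 0) :
    expSum ψ f = 0 := by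
  set c := constantCoeff (pderiv j f) with hc
  have hpd : pderiv j f = C c := by
    refine eq_C_of_mem_degreeLTSubmodule_one ?_
    rw [pderiv_eq_dirDeriv]
    exact dirDeriv_mem_degreeLTSubmodule _ hf
  obtain ⟨a, ha⟩ := (AddChar.ne_zero_iff).1 hψ
  have hshift : ∀ x : σ → F, eval (x + Pi.single j (a / c)) f = eval x f + a := by
    intro x
    have h1 := eq_zero_of_mem_degreeLTSubmodule_zero
      (translatePoly_sub_dirDeriv_mem (Pi.single j (a / c)) hf)
    have h2 : dirDeriv (Pi.single j (a / c)) f = C (a / c) * pderiv j f := by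
      rw [dirDeriv_eq_sum, Finset.sum_eq_single j]
      · simp
      · intro i _ hi; simp [hi]
      · simp
    rw [sub_sub, sub_eq_zero] at h1
    rw [← eval_translatePoly, h1, h2, hpd, ← C_mul, div_mul_cancel₀ _ hj]
    simp
  have h3 : expSum ψ f = expSum ψ f * ψ a := by
    unfold expSum
    rw [Finset.sum_mul, ← Equiv.sum_comp (Equiv.addRight (Pi.single j (a / c)))]
    refine Finset.sum_congr rfl fun x _ => ?_
    rw [Equiv.coe_addRight, hshift, AddChar.map_add_eq_mul]
  by_contra hne
  exact ha (mul_left_cancel₀ hne (by rw [← h3, mul_one]))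

/-- Weyl differencing. -/
lemma norm_expSum_sq_le (ψ : AddChar F ℂ) (f : MvPolynomial σ F) :
    ‖expSum ψ f‖ ^ 2 ≤ ∑ h : σ → F, ‖expSum ψ (translatePoly h f - f)‖ := by
  have h1 : expSum ψ f * (starRingEnd ℂ) (expSum ψ f) =
      ∑ h : σ → F, expSum ψ (translatePoly h f - f) := by
    unfold expSum
    rw [map_sum, Finset.sum_mul_sum, Finset.sum_comm]
    refine Eq.trans ?_ Finset.sum_comm
    refine Finset.sum_congr rfl fun x _ => ?_
    rw [← Equiv.sum_comp (Equiv.addLeft x)]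
    refine Finset.sum_congr rfl fun h _ => ?_
    rw [Equiv.coe_addLeft, map_sub, eval_translatePoly, sub_eq_add_neg, AddChar.map_add_eq_mul,
      AddChar.map_neg_eq_conj]
  calc ‖expSum ψ f‖ ^ 2 = ‖expSum ψ f * (starRingEnd ℂ) (expSum ψ f)‖ := by
        rw [norm_mul, RCLike.norm_conj, sq]
    _ ≤ _ := by rw [h1]; exact norm_sum_le _ _

open Classical in
/-- The number of `k`-tuples of directions for which all derivatives of the gradient of `f`
vanish. -/
noncomputable def gradientCount (k : ℕ) (f : MvPolynomial σ F) : ℕ :=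
  (Finset.univ.filter fun h : Fin k → σ → F =>
    ∀ j, constantCoeff (iterDirDeriv h (pderiv j f)) = 0).card

/-- The Taylor remainder beyond first order has degree at most `k`, and the gradient followed by `k`
directions kills it. Differencing by `h₀` therefore acts as the derivative along `h₀`. -/
lemma gradientCount_succ {k : ℕ} {f : MvPolynomial σ F} (hf : f ∈ degreeLTSubmodule σ F (k + 3)) :
    gradientCount (k + 1) f = ∑ h : σ → F, gradientCount k (translatePoly h f - f) := by
  classical
  have hsum : ∀ g : (Fin (k + 1) → σ → F) → ℕ,
      ∑ h, g h = ∑ h₀, ∑ h : Fin k → σ → F, g (Fin.cons h₀ h) := fun g => by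
    rw [← (Fin.consEquiv fun _ : Fin (k + 1) => σ → F).sum_comp g, Fintype.sum_prod_type]
    rfl
  unfold gradientCount
  simp_rw [Finset.card_filter]
  rw [hsum]
  refine Finset.sum_congr rfl fun h₀ _ => Finset.sum_congr rfl fun h _ => ?_
  refine if_congr (forall_congr' fun j => ?_) rfl rfl
  have h1 := iterDirDeriv_pderiv_eq_zero h j (translatePoly_sub_dirDeriv_mem h₀ hf)
  rw [(pderiv j).map_sub, (iterDirDeriv h).map_sub, sub_eq_zero] at h1
  rw [iterDirDeriv_cons, dirDeriv_pderiv, h1]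

/-- Weyl's inequality over finite fields. -/
theorem norm_expSum_pow_le {ψ : AddChar F ℂ} (hψ : ψ ≠ 0) (k : ℕ) {f : MvPolynomial σ F}
    (hf : f ∈ degreeLTSubmodule σ F (k + 2)) :
    ‖expSum ψ f‖ ^ 2 ^ k * ((Fintype.card F : ℝ) ^ Fintype.card σ) ^ k ≤
      ((Fintype.card F : ℝ) ^ Fintype.card σ) ^ 2 ^ k * gradientCount k f := by
  set V := (Fintype.card F : ℝ) ^ Fintype.card σ with hV
  have hV0 : 0 ≤ V := by positivity
  induction k generalizing f with
  | zero =>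
    rw [pow_zero, pow_one, pow_zero, mul_one, pow_one]
    by_cases hj : ∀ j, constantCoeff (pderiv j f) = 0
    · have : gradientCount 0 f = 1 := by
        unfold gradientCount
        simp [iterDirDeriv_zero, hj]
      rw [this, Nat.cast_one, mul_one]
      exact norm_expSum_le ψ f
    · push Not at hj
      obtain ⟨j, hj⟩ := hj
      rw [expSum_eq_zero hψ hf hj, norm_zero]
      positivity
  | succ k ih =>
    -- The power mean inequality below is stated for the exponent `n + 1`.
    obtain ⟨n, hn⟩ : ∃ n, 2 ^ k = n + 1 := ⟨2 ^ k - 1, by have := Nat.one_le_two_pow (n := k); omega⟩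
    have h1 := pow_sum_le_card_mul_sum_pow (s := (Finset.univ : Finset (σ → F)))
      (f := fun h => ‖expSum ψ (translatePoly h f - f)‖) (fun _ _ => norm_nonneg _) n
    have hcard : ((Finset.univ : Finset (σ → F)).card : ℝ) = V := by
      rw [Finset.card_univ, Fintype.card_fun, Nat.cast_pow]
    rw [hcard, ← hn] at h1
    have h2 := pow_le_pow_left₀ (by positivity) (norm_expSum_sq_le ψ f) (2 ^ k)
    calc ‖expSum ψ f‖ ^ 2 ^ (k + 1) * V ^ (k + 1)
        = (‖expSum ψ f‖ ^ 2) ^ 2 ^ k * V ^ (k + 1) := by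
          rw [← pow_mul ‖expSum ψ f‖ 2 (2 ^ k), pow_succ' 2 k]
      _ ≤ (V ^ n * ∑ h : σ → F, ‖expSum ψ (translatePoly h f - f)‖ ^ 2 ^ k) * V ^ (k + 1) := by
          gcongr
          exact h2.trans h1
      _ = V ^ (n + 1) * ∑ h : σ → F, ‖expSum ψ (translatePoly h f - f)‖ ^ 2 ^ k * V ^ k := by
          rw [← Finset.sum_mul]; ring
      _ ≤ V ^ (n + 1) * ∑ h : σ → F, V ^ 2 ^ k * gradientCount k (translatePoly h f - f) := by
          refine mul_le_mul_of_nonneg_left (Finset.sum_le_sum fun h _ => ?_) (by positivity)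
          exact ih (translatePoly_sub_mem hf h)
      _ = V ^ 2 ^ (k + 1) * gradientCount (k + 1) f := by
          rw [gradientCount_succ hf, ← Finset.mul_sum, ← hn, pow_succ 2 k, mul_two, pow_add]
          push_cast
          ring

end Weyl

/-! ### Polarization of the gradient. -/

section Polarization

variable {σ τ K : Type*} [Field K] [Fintype σ]

/-- Each derivative multiplies coefficients by integers and by linear forms `H t i`, raising their
degree by one. -/
lemma isHomogeneous_coeff_iterDirDeriv {n a : ℕ} {H : Fin n → σ → MvPolynomial τ K}
    (hH : ∀ t i, (H t i).IsHomogeneous 1) {Q : MvPolynomial σ (MvPolynomial τ K)}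
    (hQ : ∀ μ, (coeff μ Q).IsHomogeneous a) (μ : σ →₀ ℕ) :
    (coeff μ (iterDirDeriv H Q)).IsHomogeneous (a + n) := by
  induction n generalizing a Q with
  | zero => exact hQ μ
  | succ n ih =>
    rw [iterDirDeriv_succ, show a + (n + 1) = (a + 1) + n by ring]
    refine ih (fun t i => hH t.succ i) fun ν => ?_
    rw [dirDeriv_eq_sum, coeff_sum]
    refine IsHomogeneous.sum _ _ _ fun i _ => ?_
    rw [coeff_C_mul, coeff_pderiv, add_comm a 1]
    refine (hH 0 i).mul ?_
    have h1 : ((ν i : MvPolynomial τ K) + 1) = C ((ν i : K) + 1) := by simp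
    rw [h1]
    exact (hQ _).mul (isHomogeneous_C _ _)

/-- The `j`-th component of the iterated derivative of the gradient of `f`, as a polynomial in the
`k` directions. -/
noncomputable def gradientForm (k : ℕ) (f : MvPolynomial σ K) (j : σ) :
    MvPolynomial (Fin k × σ) K :=
  constantCoeff (iterDirDeriv (fun t i => X (t, i)) (map C (pderiv j f)))

lemma isHomogeneous_gradientForm (k : ℕ) (f : MvPolynomial σ K) (j : σ) :
    (gradientForm k f j).IsHomogeneous k := by
  have := isHomogeneous_coeff_iterDirDeriv (n := k) (a := 0)
    (H := fun t i => (X (t, i) : MvPolynomial (Fin k × σ) K)) (fun t i => isHomogeneous_X _ _)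
    (Q := map C (pderiv j f)) (fun μ => by rw [coeff_map]; exact isHomogeneous_C _ _) 0
  rwa [zero_add] at this

lemma eval_gradientForm (k : ℕ) (f : MvPolynomial σ K) (j : σ) (h : Fin k × σ → K) :
    eval h (gradientForm k f j) =
      constantCoeff (iterDirDeriv (fun t i => h (t, i)) (pderiv j f)) := by
  rw [gradientForm, ← constantCoeff_map, map_iterDirDeriv, map_map]
  have h1 : (eval h).comp C = RingHom.id K := by ext; simp
  have h2 : (fun t => ⇑(eval h) ∘ fun i => (X (t, i) : MvPolynomial (Fin k × σ) K)) =
      fun t i => h (t, i) := by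
    funext t i; simp
  rw [h1, h2, map_id]

/-- Euler's identity, applied once per derivative, produces the factorial. -/
lemma constantCoeff_iterDirDeriv_diagonal (n : ℕ) {Q : MvPolynomial σ K} (hQ : Q.IsHomogeneous n)
    (z : σ → K) : constantCoeff (iterDirDeriv (fun _ : Fin n => z) Q) = n.factorial * eval z Q := by
  induction n generalizing Q with
  | zero =>
    rw [iterDirDeriv_zero, ← totalDegree_zero_iff_isHomogeneous, totalDegree_eq_zero_iff_eq_C] at *
    rw [hQ]; simp
  | succ n ih =>
    have h1 : (dirDeriv z Q).IsHomogeneous n := by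
      rw [dirDeriv_eq_sum]
      refine IsHomogeneous.sum _ _ _ fun i _ => ?_
      simpa using (isHomogeneous_C σ (z i)).mul hQ.pderiv
    have h2 : eval z (dirDeriv z Q) = (n + 1 : ℕ) * eval z Q := by
      have := congrArg (eval z) hQ.sum_X_mul_pderiv
      simp only [map_sum, map_mul, eval_X, nsmul_eq_mul, map_natCast] at this
      rw [← this, dirDeriv_eq_sum]
      simp
    rw [iterDirDeriv_succ]
    change constantCoeff (iterDirDeriv (fun _ : Fin n => z) _) = _
    rw [ih h1, h2, Nat.factorial_succ]
    push_cast
    ring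

end Polarization

/-! ### Counting zeros of the polarized gradient system. -/

lemma exists_pow_mem_span_of_zeros {σ ι K : Type*} [Field K] [IsAlgClosed K] [Fintype σ]
    {F : ι → MvPolynomial σ K} (h : ∀ z, (∀ j, eval z (F j) = 0) → z = 0) :
    ∃ N, ∀ i, (X i : MvPolynomial σ K) ^ N ∈ Ideal.span (Set.range F) := by
  have hrad : ∀ i, ∃ n, (X i : MvPolynomial σ K) ^ n ∈ Ideal.span (Set.range F) := by
    intro i
    have : (X i : MvPolynomial σ K) ∈ (Ideal.span (Set.range F)).radical := by
      rw [← vanishingIdeal_zeroLocus_eq_radical (K := K)]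
      intro z hz
      have hz0 := h z fun j => by
        simpa [aeval_eq_eval] using hz (F j) (Ideal.subset_span ⟨j, rfl⟩)
      simp [hz0]
    exact this
  choose n hn using hrad
  refine ⟨∑ i, n i, fun i => ?_⟩
  have hle : n i ≤ ∑ i, n i :=
    Finset.single_le_sum (f := n) (fun _ _ => Nat.zero_le _) (Finset.mem_univ i)
  rw [← Nat.sub_add_cancel hle, pow_add]
  exact Ideal.mul_mem_left _ _ (hn i)

/-- The number of zeros of the polarized gradient system of a form whose singular locus is cut down
to the origin by `D` linear forms. -/
theorem exists_gradientCount_le (s k D : ℕ) :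
    ∃ M : ℕ, ∀ (F K : Type) [Field F] [Fintype F] [Field K] [IsAlgClosed K] [Algebra F K]
      (f : MvPolynomial (Fin s) F) (L : Fin D → Fin s → K),
      f.IsHomogeneous (k + 2) → ((k + 1).factorial : K) ≠ 0 →
      (∀ z ∈ singularLocus (map (algebraMap F K) f), (∀ m, ∑ i, L m i * z i = 0) → z = 0) →
      gradientCount (k + 1) f ≤ M * Fintype.card F ^ (k * s + D) := by
  classical
  let e : Fin s ⊕ ((Fin k × Fin s) ⊕ Fin D) → ℕ := Sum.elim (fun _ => k + 1) (fun _ => 1)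
  obtain ⟨N, hN⟩ := exists_uniform_exponent (Fin (k + 1) × Fin s) e
  set n := Fintype.card (Fin (k + 1) × Fin s) with hn
  refine ⟨(N + 1) ^ n * (n + 1) ^ (k * s + D), ?_⟩
  intro F K _ _ _ _ _ f L hf hfac hL
  set fK := map (algebraMap F K) f with hfK
  let G : Fin s → MvPolynomial (Fin (k + 1) × Fin s) K := fun j => gradientForm (k + 1) fK j
  -- The first `k * s` forms cut out the diagonal, and the other `D` impose `L` on the common
  -- direction.
  let ℓ : (Fin k × Fin s) ⊕ Fin D → Fin (k + 1) × Fin s → K :=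
    Sum.elim (fun u => Pi.single (u.1.succ, u.2) 1 - Pi.single (0, u.2) 1)
      (fun m u => if u.1 = 0 then L m u.2 else 0)
  have hG : ∀ j, (G j).IsHomogeneous (k + 1) := fun j => isHomogeneous_gradientForm _ _ _
  have hzero : ∀ h, (∀ j, eval h (Sum.elim G (fun a => linearForm (ℓ a)) j) = 0) → h = 0 := by
    intro h hh
    have hdiag : ∀ t i, h (t, i) = h (0, i) := by
      intro t i
      refine Fin.cases rfl (fun t => ?_) t
      have := hh (Sum.inr (Sum.inl (t, i)))
      simp only [Sum.elim_inr, eval_linearForm, ℓ, Sum.elim_inl, Pi.sub_apply, sub_mul,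
        Finset.sum_sub_distrib, Pi.single_apply, ite_mul, one_mul, zero_mul, Finset.sum_ite_eq',
        Finset.mem_univ, if_true] at this
      exact sub_eq_zero.1 this
    have hz : (fun i => h (0, i)) = 0 := by
      refine hL _ (fun j => ?_) fun m => ?_
      · have h1 := hh (Sum.inl j)
        simp only [Sum.elim_inl, G] at h1
        rw [eval_gradientForm] at h1
        have h2 : (fun (t : Fin (k + 1)) i => h (t, i)) = fun _ i => h (0, i) := by
          funext t i; exact hdiag t i
        rw [h2, constantCoeff_iterDirDeriv_diagonal (k + 1)
          (hf.map _).pderiv] at h1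
        exact (mul_eq_zero.1 h1).resolve_left hfac
      · have := hh (Sum.inr (Sum.inr m))
        simp only [Sum.elim_inr, eval_linearForm, ℓ] at this
        rw [Fintype.sum_prod_type, Finset.sum_eq_single 0] at this
        · simpa using this
        · intro t _ ht; simp [ht]
        · simp
    funext u
    rw [show u = (u.1, u.2) from rfl, hdiag]
    exact congrFun hz u.2
  have hpow := hN K (Sum.elim G fun a => linearForm (ℓ a))
    (by rintro (j | a); exacts [hG j, isHomogeneous_linearForm _])
    (exists_pow_mem_span_of_zeros hzero)
  have hinj : Function.Injective (algebraMap F K) := (algebraMap F K).injective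
  let emb : (Fin (k + 1) → Fin s → F) → (Fin (k + 1) × Fin s → K) :=
    fun h u => algebraMap F K (h u.1 u.2)
  have hemb : Function.Injective emb := by
    intro h h' hh
    funext t i
    exact hinj (congrFun hh (t, i))
  let A : Finset K := Finset.univ.image (algebraMap F K)
  have hA : A.card = Fintype.card F := by
    rw [Finset.card_image_of_injective _ hinj, Finset.card_univ]
  -- `N + 1` replaces `N` because the point count needs a positive exponent.
  have hcard := card_le_of_pow_mem_span hG (ℓ := ℓ) (N := N + 1) (by omega)
    (fun i => by rw [pow_succ]; exact Ideal.mul_mem_right _ _ (hpow i)) A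
    ((Finset.univ.filter fun h : Fin (k + 1) → Fin s → F =>
      ∀ j, constantCoeff (iterDirDeriv h (pderiv j f)) = 0).image emb)
    (by
      intro a ha u
      obtain ⟨h, -, rfl⟩ := Finset.mem_image.1 ha
      exact Finset.mem_image_of_mem _ (Finset.mem_univ _))
    (by
      intro a ha j
      obtain ⟨h, hh, rfl⟩ := Finset.mem_image.1 ha
      rw [eval_gradientForm]
      have h1 := map_iterDirDeriv (algebraMap F K) h (pderiv j f)
      rw [← pderiv_map] at h1
      have h2 := congrArg constantCoeff h1
      rw [constantCoeff_map, (Finset.mem_filter.1 hh).2 j, map_zero] at h2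
      exact h2.symm)
  rw [Finset.card_image_of_injective _ hemb, hA, ← hn] at hcard
  have hΛ : Fintype.card ((Fin k × Fin s) ⊕ Fin D) = k * s + D := by simp
  rw [hΛ] at hcard
  have hq : 1 ≤ Fintype.card F := Fintype.card_pos
  calc gradientCount (k + 1) f ≤ _ := by
        unfold gradientCount
        convert hcard
    _ ≤ (N + 1) ^ n * ((n + 1) * Fintype.card F) ^ (k * s + D) := by
        gcongr
        rw [add_mul, one_mul]
        omega
    _ = _ := by rw [mul_pow, mul_assoc]

lemma MvPolynomial.IsHomogeneous.eval_smul {σ K : Type*} [Field K] {P : MvPolynomial σ K} {n : ℕ}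
    (hP : P.IsHomogeneous n) (c : K) (z : σ → K) : eval (c • z) P = c ^ n * eval z P := by
  rw [eval_eq, eval_eq, Finset.mul_sum]
  refine Finset.sum_congr rfl fun μ hμ => ?_
  have hdeg : ∑ i ∈ μ.support, μ i = n := by
    by_contra hne
    exact mem_support_iff.1 hμ (hP.coeff_eq_zero hne)
  simp only [Pi.smul_apply, smul_eq_mul, mul_pow, Finset.prod_mul_distrib,
    Finset.prod_pow_eq_pow_sum, hdeg]
  ring

lemma gradientCount_add_of_mem {σ F : Type*} [Fintype σ] [DecidableEq σ] [Field F] [Fintype F]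
    {k : ℕ} (f : MvPolynomial σ F) {r : MvPolynomial σ F}
    (hr : r ∈ degreeLTSubmodule σ F (k + 1)) : gradientCount k (f + r) = gradientCount k f := by
  unfold gradientCount
  congr 1
  ext h
  simp only [Finset.mem_filter, Finset.mem_univ, true_and]
  refine forall_congr' fun j => ?_
  rw [(pderiv j).map_add, (iterDirDeriv h).map_add, iterDirDeriv_pderiv_eq_zero h j hr, add_zero]

/-! ### Bounds for exponential sums with a given leading form. -/

section ExponentialSums

variable {F K : Type} [Field F] [Fintype F] [Field K] [Algebra F K]

/-- The exponential sum of a polynomial whose leading form is linear and has a singular locus of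
positive codimension vanishes. -/
lemma expSum_eq_zero_of_codimAtLeast [Infinite K] {s B : ℕ} {ψ : AddChar F ℂ} (hψ : ψ ≠ 0)
    {f r : MvPolynomial (Fin s) F} (hf : f.IsHomogeneous 1)
    (hr : r ∈ degreeLTSubmodule (Fin s) F 1) (hB : 1 ≤ B)
    (hcodim : CodimAtLeast (singularLocus (map (algebraMap F K) f)) B) :
    expSum ψ (f + r) = 0 := by
  have hfr : f + r ∈ degreeLTSubmodule (Fin s) F 2 :=
    Submodule.add_mem _ (hf.mem_degreeLTSubmodule (by omega)) (degreeLTSubmodule_mono (by omega) hr)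
  by_contra hne
  have hall : ∀ j, constantCoeff (pderiv j (f + r)) = 0 := by
    by_contra! hcon
    obtain ⟨j, hj⟩ := hcon
    exact hne (expSum_eq_zero hψ hfr hj)
  have hpd : ∀ j, pderiv j f = 0 := by
    intro j
    have h1 : pderiv j (f + r) = pderiv j f := by
      rw [(pderiv j).map_add, eq_C_of_mem_degreeLTSubmodule_one hr, pderiv_C, add_zero]
    rw [← h1, eq_C_of_mem_degreeLTSubmodule_one (P := pderiv j (f + r)), hall, C_0]
    rw [pderiv_eq_dirDeriv]
    exact dirDeriv_mem_degreeLTSubmodule _ hfr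
  have huniv : ∀ z : Fin s → K, z ∈ singularLocus (map (algebraMap F K) f) := by
    intro z j
    rw [pderiv_map, hpd, map_zero, map_zero]
  obtain ⟨D, hD, L, hL⟩ := exists_linearForms_of_codimAtLeast
    (fun z _ c => huniv (c • z)) ⟨0, huniv 0⟩ hcodim
  -- The singular locus is the whole space, yet `D < s` linear forms would have only the trivial
  -- common zero.
  have hinj : Function.Injective (Matrix.toLin' (Matrix.of L)) := by
    rw [injective_iff_map_eq_zero]
    intro z hz
    refine hL z (huniv z) fun k => ?_
    simpa [Matrix.mulVec, dotProduct] using congrFun hz k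
  have := LinearMap.finrank_le_finrank_of_injective hinj
  simp at this
  omega

/-- The exponential sum of a polynomial whose leading form has degree at least `2` and a singular
locus of large codimension is small. -/
lemma norm_expSum_mul_le [IsAlgClosed K] {s k B R : ℕ} {ψ : AddChar F ℂ} (hψ : ψ ≠ 0)
    {f r : MvPolynomial (Fin s) F} (hf : f.IsHomogeneous (k + 2))
    (hr : r ∈ degreeLTSubmodule (Fin s) F (k + 2)) (hfac : ((k + 1).factorial : K) ≠ 0)
    (hB : 2 ^ (k + 1) * (R + 1) + 1 ≤ B)
    (hcodim : CodimAtLeast (singularLocus (map (algebraMap F K) f)) B)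
    (hM : ∀ D ≤ s, (exists_gradientCount_le s k D).choose ≤ Fintype.card F) :
    ‖expSum ψ (f + r)‖ * (Fintype.card F : ℝ) ^ (R + 1) ≤ (Fintype.card F : ℝ) ^ s := by
  set q := Fintype.card F with hq
  have hq1 : (1 : ℝ) ≤ q := by exact_mod_cast Fintype.card_pos
  have hcone : ∀ z ∈ singularLocus (map (algebraMap F K) f), ∀ c : K,
      c • z ∈ singularLocus (map (algebraMap F K) f) := by
    intro z hz c j
    rw [(hf.map (algebraMap F K)).pderiv.eval_smul, hz j, mul_zero]
  have hzero : (0 : Fin s → K) ∈ singularLocus (map (algebraMap F K) f) := by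
    intro j
    rw [← zero_smul K (0 : Fin s → K), (hf.map (algebraMap F K)).pderiv.eval_smul,
      show k + 2 - 1 = k + 1 from rfl, pow_succ, mul_zero, zero_mul]
  have : Infinite K := IsAlgClosed.instInfinite
  obtain ⟨D, hD, L, hL⟩ := exists_linearForms_of_codimAtLeast hcone ⟨0, hzero⟩ hcodim
  have hcount := (exists_gradientCount_le s k D).choose_spec F K f L hf hfac hL
  have hMD := hM D (by omega)
  -- The constant is absorbed by one extra factor `q`.
  have hcount' : (gradientCount (k + 1) (f + r) : ℝ) ≤ (q : ℝ) ^ (k * s + D + 1) := by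
    rw [gradientCount_add_of_mem f hr]
    have : gradientCount (k + 1) f ≤ q ^ (k * s + D + 1) :=
      hcount.trans (by rw [pow_succ']; exact Nat.mul_le_mul_right _ hMD)
    exact_mod_cast this
  have hfr : f + r ∈ degreeLTSubmodule (Fin s) F (k + 1 + 2) :=
    Submodule.add_mem _ (hf.mem_degreeLTSubmodule (by omega)) (degreeLTSubmodule_mono (by omega) hr)
  have hweyl := norm_expSum_pow_le hψ (k + 1) hfr
  rw [Fintype.card_fin, ← hq] at hweyl
  set S := ‖expSum ψ (f + r)‖ with hS
  have hS0 : 0 ≤ S := norm_nonneg _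
  set m := 2 ^ (k + 1) with hm
  have hm0 : m ≠ 0 := by positivity
  -- Since `D + B ≤ s` and `m * (R + 1) + 1 ≤ B`, the exponent `m * (R + 1) + (k * s + D + 1)` is at
  -- most `s * (k + 1)`.
  have h1 : (S * (q : ℝ) ^ (R + 1)) ^ m * (q : ℝ) ^ (k * s + D + 1) ≤
      ((q : ℝ) ^ s) ^ m * (q : ℝ) ^ (k * s + D + 1) := by
    calc (S * (q : ℝ) ^ (R + 1)) ^ m * (q : ℝ) ^ (k * s + D + 1)
        = S ^ m * (q : ℝ) ^ (m * (R + 1) + (k * s + D + 1)) := by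
          rw [mul_pow, ← pow_mul, mul_assoc, ← pow_add, mul_comm (R + 1) m]
      _ ≤ S ^ m * (q : ℝ) ^ (s * (k + 1)) := by
          refine mul_le_mul_of_nonneg_left (pow_le_pow_right₀ hq1 ?_) (by positivity)
          have : s * (k + 1) = k * s + s := by ring
          omega
      _ = S ^ m * ((q : ℝ) ^ s) ^ (k + 1) := by rw [pow_mul]
      _ ≤ ((q : ℝ) ^ s) ^ m * gradientCount (k + 1) (f + r) := hweyl
      _ ≤ _ := by gcongr
  exact le_of_pow_le_pow_left₀ hm0 (by positivity) (le_of_mul_le_mul_right h1 (by positivity))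

end ExponentialSums

/-! ### Detecting common zeros and assembling the estimate. -/

lemma addChar_sum_eq_prod {ι A M : Type*} [AddCommMonoid A] [CommMonoid M] (ψ : AddChar A M)
    (s : Finset ι) (f : ι → A) : ψ (∑ i ∈ s, f i) = ∏ i ∈ s, ψ (f i) := by
  classical
  induction s using Finset.induction_on with
  | empty => simp
  | insert i s hi ih => rw [Finset.sum_insert hi, Finset.prod_insert hi, AddChar.map_add_eq_mul, ih]

/-- Detection of the common zeros by additive characters. -/
lemma sum_expSum_eq {p : ℕ} [Fact p.Prime] {R s : ℕ}
    (g : Fin R → MvPolynomial (Fin s) (ZMod p)) :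
    ∑ a : Fin R → ZMod p, expSum ZMod.stdAddChar (∑ i, C (a i) * g i) =
      (commonZeros g).ncard * (p : ℂ) ^ R := by
  classical
  have hx : ∀ x : Fin s → ZMod p, ∑ a : Fin R → ZMod p,
      (ZMod.stdAddChar (eval x (∑ i, C (a i) * g i)) : ℂ) =
        if x ∈ commonZeros g then (p : ℂ) ^ R else 0 := by
    intro x
    -- The sum over `a` factors over the equations, each factor being `p` or `0`.
    have h1 : ∀ a : Fin R → ZMod p, (ZMod.stdAddChar (eval x (∑ i, C (a i) * g i)) : ℂ) =
        ∏ i, ZMod.stdAddChar (a i * eval x (g i)) := fun a => by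
      rw [map_sum, addChar_sum_eq_prod]
      simp
    simp_rw [h1]
    have h2 := Finset.prod_univ_sum (fun _ : Fin R => (Finset.univ : Finset (ZMod p)))
      (fun i t => (ZMod.stdAddChar (t * eval x (g i)) : ℂ))
    rw [Fintype.piFinset_univ] at h2
    rw [← h2]
    simp_rw [AddChar.sum_mulShift _ (ZMod.isPrimitive_stdAddChar p), ZMod.card]
    push_cast
    rw [Finset.prod_ite_zero]
    simp only [Finset.mem_univ, forall_const, Finset.prod_const, Finset.card_univ, Fintype.card_fin]
    exact if_congr (by simp [commonZeros]) rfl rfl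
  unfold expSum
  rw [Finset.sum_comm]
  simp_rw [hx]
  rw [← Finset.sum_filter, Finset.sum_const, nsmul_eq_mul, Set.ncard_eq_toFinset_card']
  congr 3
  ext x
  simp

/-- The exponential sums attached to a nontrivial combination of forms of large Birch rank are
small. -/
lemma norm_expSum_combination_mul_le {p : ℕ} [Fact p.Prime] {R d s B : ℕ}
    {g : Fin R → MvPolynomial (Fin s) (ZMod p)} {deg : Fin R → ℕ} (hdp : d < p)
    (hdeg : ∀ i, 1 ≤ deg i ∧ deg i ≤ d) (hg : ∀ i, (g i).IsHomogeneous (deg i))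
    (hB : 2 ^ d * (R + 1) + 1 ≤ B)
    (hrank : ∀ l : ℕ, 1 ≤ l → l ≤ d → (∃ i, deg i = l) → BlockBirchRankAtLeast g deg l B)
    (hM : ∀ k < d, ∀ D ≤ s, (exists_gradientCount_le s k D).choose ≤ p)
    {a : Fin R → ZMod p} (ha : a ≠ 0) :
    ‖expSum ZMod.stdAddChar (∑ i, C (a i) * g i)‖ * (p : ℝ) ^ (R + 1) ≤ (p : ℝ) ^ s := by
  classical
  let K := AlgebraicClosure (ZMod p)
  obtain ⟨i₁, hi₁⟩ := Function.ne_iff.1 ha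
  -- Only degrees with a nonzero coefficient compete, so `f` below is the leading form and `r` has
  -- smaller degree.
  obtain ⟨i₀, hi₀, hmax⟩ := Finset.exists_max_image (Finset.univ.filter fun i => a i ≠ 0) deg
    ⟨i₁, by simpa using hi₁⟩
  have hai₀ : a i₀ ≠ 0 := (Finset.mem_filter.1 hi₀).2
  set l := deg i₀ with hl
  set f : MvPolynomial (Fin s) (ZMod p) := ∑ i : {i // deg i = l}, C (a i.1) * g i.1 with hf
  set r : MvPolynomial (Fin s) (ZMod p) := ∑ i : {i // ¬ deg i = l}, C (a i.1) * g i.1 with hr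
  have hsplit : ∑ i, C (a i) * g i = f + r :=
    (Fintype.sum_subtype_add_sum_subtype (fun i => deg i = l) fun i => C (a i) * g i).symm
  have hfhom : f.IsHomogeneous l := IsHomogeneous.sum _ _ _ fun i _ => by
    simpa [i.2] using (hg i.1).C_mul (a i.1)
  have hrdeg : r ∈ degreeLTSubmodule (Fin s) (ZMod p) l := by
    refine Submodule.sum_mem _ fun i _ => ?_
    by_cases hai : a i.1 = 0
    · rw [hai, C_0, zero_mul]
      exact Submodule.zero_mem _
    · refine ((hg i.1).C_mul (a i.1)).mem_degreeLTSubmodule ?_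
      exact lt_of_le_of_ne (hmax i.1 (by simpa using hai)) i.2
  have hcodim : CodimAtLeast (singularLocus (map (algebraMap (ZMod p) K) f)) B := by
    have h1 := hrank l (hdeg i₀).1 (hdeg i₀).2 ⟨i₀, rfl⟩ (fun i => algebraMap (ZMod p) K (a i.1))
      (fun h0 => hai₀ ((map_eq_zero _).1 (congrFun h0 ⟨i₀, rfl⟩)))
    have h2 : map (algebraMap (ZMod p) K) f = ∑ i : {i // deg i = l},
        C (algebraMap (ZMod p) K (a i.1)) * map (algebraMap (ZMod p) K) (g i.1) := by
      rw [hf, map_sum]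
      simp
    rw [h2]
    exact h1
  have hψ : (ZMod.stdAddChar : AddChar (ZMod p) ℂ) ≠ 0 := by
    intro h0
    refine ZMod.isPrimitive_stdAddChar p (one_ne_zero) ?_
    rw [h0]
    ext; simp
  have : Infinite K := IsAlgClosed.instInfinite
  rw [hsplit]
  rcases Nat.lt_or_ge l 2 with hl2 | hl2
  · have hl1 : l = 1 := by have := (hdeg i₀).1; omega
    rw [hl1] at hfhom hrdeg
    rw [expSum_eq_zero_of_codimAtLeast hψ hfhom hrdeg (by omega) hcodim, norm_zero, zero_mul]
    positivity
  · obtain ⟨k, hk⟩ : ∃ k, l = k + 2 := ⟨l - 2, by omega⟩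
    have hkd : k + 2 ≤ d := by have := (hdeg i₀).2; omega
    rw [hk] at hfhom hrdeg
    have hfac : ((k + 1).factorial : K) ≠ 0 := by
      rw [Ne, CharP.cast_eq_zero_iff K p, Nat.Prime.dvd_factorial Fact.out]
      omega
    have h := norm_expSum_mul_le (R := R) hψ hfhom hrdeg hfac (le_trans (by gcongr <;> omega) hB)
      hcodim (fun D hD => by rw [ZMod.card]; exact hM k (by omega) D hD)
    rwa [ZMod.card] at h

theorem lemma5p1 :
    ∃ (B₀ : ℕ → ℕ → ℕ) (p₀ : ℕ → ℕ → ℕ),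
      ∀ R d s : ℕ, 1 ≤ R → 1 ≤ d → 1 ≤ s →
      ∀ (p : ℕ) [Fact p.Prime], p₀ s d < p →
      ∀ (g : Fin R → MvPolynomial (Fin s) (ZMod p)) (deg : Fin R → ℕ),
        (∀ i, 1 ≤ deg i ∧ deg i ≤ d) →
        (∀ i, (g i).IsHomogeneous (deg i)) →
        (∀ l : ℕ, 1 ≤ l → l ≤ d → (∃ i, deg i = l) → BlockBirchRankAtLeast g deg l (B₀ R d)) →
        |((commonZeros g).ncard : ℝ) - (p : ℝ) ^ ((s : ℤ) - (R : ℤ))|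
          ≤ (p : ℝ) ^ ((s : ℤ) - (R : ℤ) - 1) := by
  classical
  -- In `B₀`, the factor `2 ^ d` dominates the Weyl exponent `2 ^ (k + 1)`, `R + 1` is the required
  -- saving, and the final `1` pays for the counting constant. `p₀` exceeds all those constants, and
  -- its summand `d` keeps the factorials nonzero modulo `p`.
  refine ⟨fun R d => 2 ^ d * (R + 1) + 1, fun s d => d + ∑ k ∈ Finset.range d,
    ∑ D ∈ Finset.range (s + 1), (exists_gradientCount_le s k D).choose, ?_⟩
  intro R d s _ _ _ p _ hp g deg hdeg hg hrank
  dsimp only at hp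
  have hM : ∀ k < d, ∀ D ≤ s, (exists_gradientCount_le s k D).choose ≤ p := by
    intro k hk D hD
    have h1 := Finset.single_le_sum (f := fun D => (exists_gradientCount_le s k D).choose)
      (fun _ _ => Nat.zero_le _) (Finset.mem_range.2 (Nat.lt_add_one_of_le hD))
    have h2 := Finset.single_le_sum (f := fun k => ∑ D ∈ Finset.range (s + 1),
      (exists_gradientCount_le s k D).choose) (fun _ _ => Nat.zero_le _) (Finset.mem_range.2 hk)
    omega
  have hp0 : (0 : ℝ) < p := by exact_mod_cast (Fact.out : p.Prime).pos
  have hsmall : ∀ a : Fin R → ZMod p, a ≠ 0 →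
      ‖expSum ZMod.stdAddChar (∑ i, C (a i) * g i)‖ ≤ (p : ℝ) ^ s / (p : ℝ) ^ (R + 1) := by
    intro a ha
    rw [le_div_iff₀ (by positivity)]
    exact norm_expSum_combination_mul_le (by omega) hdeg hg le_rfl hrank hM ha
  have hsum := sum_expSum_eq g
  -- The term `a = 0` is the main term `p ^ s`.
  rw [← Finset.add_sum_erase _ _ (Finset.mem_univ 0)] at hsum
  have hzero : expSum ZMod.stdAddChar
      (∑ i, C ((0 : Fin R → ZMod p) i) * g i) = (p : ℂ) ^ s := by
    simp [expSum]
  rw [hzero] at hsum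
  have hmain : |((commonZeros g).ncard : ℝ) * (p : ℝ) ^ R - (p : ℝ) ^ s| ≤
      (p : ℝ) ^ R * ((p : ℝ) ^ s / (p : ℝ) ^ (R + 1)) := by
    have h1 : ((((commonZeros g).ncard : ℝ) * (p : ℝ) ^ R - (p : ℝ) ^ s : ℝ) : ℂ) =
        ∑ a ∈ Finset.univ.erase (0 : Fin R → ZMod p),
          expSum ZMod.stdAddChar (∑ i, C (a i) * g i) := by
      push_cast
      rw [← hsum]
      ring
    rw [← Real.norm_eq_abs, ← Complex.norm_real, h1]
    refine (norm_sum_le _ _).trans ?_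
    refine (Finset.sum_le_card_nsmul _ _ _ fun a ha => hsmall a (Finset.ne_of_mem_erase ha)).trans ?_
    rw [nsmul_eq_mul]
    refine mul_le_mul_of_nonneg_right ?_ (by positivity)
    have h2 : (Finset.univ.erase (0 : Fin R → ZMod p)).card ≤ p ^ R :=
      (Finset.card_le_univ _).trans (by simp [ZMod.card])
    exact_mod_cast h2
  have hpR : (0 : ℝ) < (p : ℝ) ^ R := by positivity
  rw [zpow_sub_one₀ hp0.ne', zpow_sub₀ hp0.ne', zpow_natCast, zpow_natCast]
  have h3 : ((commonZeros g).ncard : ℝ) - (p : ℝ) ^ s / (p : ℝ) ^ R =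
      (((commonZeros g).ncard : ℝ) * (p : ℝ) ^ R - (p : ℝ) ^ s) / (p : ℝ) ^ R := by
    field_simp
  rw [h3, abs_div, abs_of_pos hpR, div_le_iff₀ hpR]
  refine hmain.trans (le_of_eq ?_)
  rw [pow_succ]
  field_simp
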